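/- For $R>0$ let $\Omega_R=(-\pi,\pi)\times(-R,R)$. Let $\alpha\in\mathbb R$, let $k\in\mathbb C$ with $\operatorname{Re}k\ge 0$ and $\operatorname{Im}k\ge 0$ (for instance $k>0$ or $k=\mathrm i$), put $\alpha_j=j+\alpha$ for $j\in\mathbb Z$, and assume that $k^2\ne\alpha_j^2$ for all $j\in\mathbb Z$. Let $\beta_j=(k^2-\alpha_j^2)^{1/2}$ (principal branch, so that $\operatorname{Re}\beta_j\ge0$ and $\operatorname{Im}\beta_j\ge0$), and let $$G_{k,\alpha}(x)=\frac{\mathrm i}{4\pi}\sum_{j\in\mathbb Z}\frac1{\beta_j}\,e^{\mathrm i\alpha_jx_1+\mathrm i\beta_j|x_2|},\qquad x\in\mathbb R^2,\ x\ne(2\pi m,0)\text{ for all }m\in\mathbb Z,$$ be the $\alpha$-quasi-periodic Green's function of the Helmholtz equation (the series being the limit of its partial sums over $-N\le j\le N$). Let $D$ be a measurable set with $D\subset\Omega_\rho$ for some $\rho>0$. For $\ell\in\mathbb N$ and $R>0$, let $H^\ell_\alpha(\Omega_R)$ be the space of those $u\in H^\ell(\Omega_R)$ that are the restriction to $\Omega_R$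 of some $U\in H^\ell_{\mathrm{loc}}(\mathbb R^2)$ with $U(x_1+2\pi,x_2)=e^{2\pi\mathrm i\alpha}U(x_1,x_2)$, equipped with the norm of $H^\ell(\Omega_R)$, $\|u\|_{H^\ell(\Omega_R)}^2=\sum_{|m|\le\ell}\|\partial^mu\|_{L^2(\Omega_R)}^2$. Then, for all $f\in L^2(D)$ and $x\in\mathbb R^2$, the integral $$(V_kf)(x)=\int_DG_{k,\alpha}(x-y)f(y)\,\mathrm dy$$ converges absolutely, and for every $R>0$ the linear operator $V_k$ is bounded from $L^2(D)$ into $H^2_\alpha(\Omega_R)$: $V_kf\in H^2_\alpha(\Omega_R)$ for all $f\in L^2(D)$, and there is a constant $C$ (independent of $f$) with $\|V_kf\|_{H^2(\Omega_R)}\le C\,\|f\|_{L^2(D)}$ for all $f\in L^2(D)$. -/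

import Mathlib

open MeasureTheory
open scoped ContDiff ENNReal NNReal

noncomputable section

namespace QPVolumePotential

/-- `α_j = j + α`. -/
def alphaj (α : ℝ) (j : ℤ) : ℝ := (j : ℝ) + α

/-- `β_j = (k² - α_j²)^{1/2}`, principal branch: for `k` in the closed first quadrant the radicand
lies in the closed upper half plane, so `β_j` has nonnegative real and imaginary parts. -/
def betaj (k : ℂ) (α : ℝ) (j : ℤ) : ℂ := (k ^ 2 - (alphaj α j : ℂ) ^ 2) ^ (1 / 2 : ℂ)

/-- The `α`-quasi-periodic Green's function
`G_{k,α}(x) = (i / 4π) ∑_j (1 / β_j) exp(i α_j x₁ + i β_j |x₂|)`.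
The series converges absolutely for `x₂ ≠ 0` and only conditionally for `x₂ = 0`, `x₁ ∉ 2πℤ`;
it is the limit of the partial sums over `-N ≤ j ≤ N`. -/
def green (k : ℂ) (α : ℝ) (x : ℝ × ℝ) : ℂ :=
  Complex.I / (4 * (Real.pi : ℂ)) *
    ∑'[SummationFilter.symmetricIcc ℤ] j : ℤ, (1 / betaj k α j) *
      Complex.exp (Complex.I * (alphaj α j : ℂ) * (x.1 : ℂ)
        + Complex.I * betaj k α j * ((|x.2| : ℝ) : ℂ))

/-- The volume potential `(V_k f)(x) = ∫_D G_{k,α}(x - y) f(y) dy`. -/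
def volumePotential (k : ℂ) (α : ℝ) (D : Set (ℝ × ℝ))
    (f : Lp ℂ 2 ((volume : Measure (ℝ × ℝ)).restrict D)) : ℝ × ℝ → ℂ :=
  fun x => ∫ y in D, green k α (x - y) * f y

/-- `Ω_R = (-π, π) × (-R, R)`. -/
def cell (R : ℝ) : Set (ℝ × ℝ) := Set.Ioo (-Real.pi) Real.pi ×ˢ Set.Ioo (-R) R

/-- The open Euclidean disc in the plane. -/
def disc (c : ℝ × ℝ) (r : ℝ) : Set (ℝ × ℝ) :=
  {x | (x.1 - c.1) ^ 2 + (x.2 - c.2) ^ 2 < r ^ 2}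

/-- Classical partial derivative in `x₁`. -/
def pderiv₁ (φ : ℝ × ℝ → ℂ) : ℝ × ℝ → ℂ := fun x => fderiv ℝ φ x (1, 0)

/-- Classical partial derivative in `x₂`. -/
def pderiv₂ (φ : ℝ × ℝ → ℂ) : ℝ × ℝ → ℂ := fun x => fderiv ℝ φ x (0, 1)

/-- `v` is the weak derivative `∂₁^{m₁} ∂₂^{m₂} u` in the open set `U`. -/
def HasWeakDeriv (U : Set (ℝ × ℝ)) (m : ℕ × ℕ) (u v : ℝ × ℝ → ℂ) : Prop :=
  LocallyIntegrableOn u U ∧ LocallyIntegrableOn v U ∧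
    ∀ φ : ℝ × ℝ → ℂ, ContDiff ℝ ∞ φ → HasCompactSupport φ → tsupport φ ⊆ U →
      ∫ x in U, u x * (pderiv₁^[m.1] (pderiv₂^[m.2] φ)) x
        = (-1) ^ (m.1 + m.2) * ∫ x in U, v x * φ x

open Classical in
/-- The weak derivative of `u` in `U` of multi-index `m`, unique up to null sets
(and `0` if there is none). -/
def weakDeriv (U : Set (ℝ × ℝ)) (m : ℕ × ℕ) (u : ℝ × ℝ → ℂ) : ℝ × ℝ → ℂ :=
  if h : ∃ v, HasWeakDeriv U m u v then h.choose else 0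

/-- `u ∈ H^ℓ(U)`: all weak derivatives up to order `ℓ` exist and lie in `L²(U)`. -/
def MemH (ℓ : ℕ) (U : Set (ℝ × ℝ)) (u : ℝ × ℝ → ℂ) : Prop :=
  ∀ m : ℕ × ℕ, m.1 + m.2 ≤ ℓ →
    ∃ v, HasWeakDeriv U m u v ∧ MemLp v 2 ((volume : Measure (ℝ × ℝ)).restrict U)

/-- The norm `(∑_{|m| ≤ ℓ} ‖∂^m u‖²_{L²(U)})^{1/2}` of a function `u ∈ H^ℓ(U)`. -/
def normH (ℓ : ℕ) (U : Set (ℝ × ℝ)) (u : ℝ × ℝ → ℂ) : ℝ≥0∞ :=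
  (∑ n ∈ Finset.range (ℓ + 1), ∑ m ∈ Finset.HasAntidiagonal.antidiagonal n,
    eLpNorm (weakDeriv U m u) 2 ((volume : Measure (ℝ × ℝ)).restrict U) ^ 2) ^ (1 / 2 : ℝ)

/-- `u ∈ H^ℓ_loc(ℝ²)`: `u ∈ H^ℓ(B)` for all open discs `B`. -/
def MemHloc (ℓ : ℕ) (u : ℝ × ℝ → ℂ) : Prop := ∀ c r, MemH ℓ (disc c r) u

/-- `u(x₁ + 2π, x₂) = e^{2πiα} u(x₁, x₂)`. -/
def IsQuasiPeriodic (α : ℝ) (u : ℝ × ℝ → ℂ) : Prop :=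
  ∀ x₁ x₂ : ℝ, u (x₁ + 2 * Real.pi, x₂)
    = Complex.exp (2 * (Real.pi : ℂ) * Complex.I * (α : ℂ)) * u (x₁, x₂)

/-- `u ∈ H^ℓ_α(Ω_R)`: `u ∈ H^ℓ(Ω_R)` is the restriction to `Ω_R` of an `α`-quasi-periodic
function in `H^ℓ_loc(ℝ²)`. -/
def MemHalpha (ℓ : ℕ) (α R : ℝ) (u : ℝ × ℝ → ℂ) : Prop :=
  MemH ℓ (cell R) u ∧ ∃ W : ℝ × ℝ → ℂ, IsQuasiPeriodic α W ∧ MemHloc ℓ W ∧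
    u =ᵐ[(volume : Measure (ℝ × ℝ)).restrict (cell R)] W

end QPVolumePotential

end

namespace QPVolumePotential

/-! ### The square roots `β_j` -/

/-! Extend `f` by zero to a density `F` on the plane and expand in Fourier modes in `x₁`. The
potential becomes `∑_j exp(i α_j x₁) u_j(x₂)`, where `u_j` is the convolution on the line of the
coefficient `f_j` of `F` with `κ_j(t) = i/(4πβ_j) exp(i β_j |t|)`. This kernel solves `κ_j'' + β_j²
κ_j = -(2π)⁻¹ δ`, so `u_j'' = -β_j² u_j - (2π)⁻¹ f_j`.

Write `w_j = 1 + |α_j|`. Since `Im β_j ≥ |α_j| - |k|` and `|β_j| ≥ c w_j`, on bounded intervals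
`κ_j` is dominated by a multiple of `w_j⁻¹ exp(-w_j |t|)` and `κ_j'` by a multiple of `exp(-w_j
|t|)`. The `L¹` norms of these majorants are of order `w_j⁻²` and `w_j⁻¹`. Young's inequality and
the differential equation then bound `(iα_j)^{m₁} u_j^{(m₂)}` in `L²(-R, R)` by `f_j`, uniformly in
`j`, for `m₁ + m₂ ≤ 2` (`exists_lintegral_mul_profile_sq_le`).

Bessel's inequality sums the squares of the `f_j`. The modes are orthogonal over a whole number of
periods, so the formally differentiated series converges in `L²` of a box
(`exists_memLp_hasSum_integral_mode`). Its sum is the weak derivative because both sides of the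
defining identity can be integrated term by term (`IsDensity.exists_hasWeakDeriv_potential`). For
the undifferentiated series this rests on a bound of order `w_j^{-3/2}`, uniform on horizontal
strips (`exists_lintegral_mode_sub_mul_le`), which also gives the absolute convergence of the
integral. Boxes of several periods cover every disc, whence `H²_loc`. -/

lemma betaj_sq (k : ℂ) (α : ℝ) (j : ℤ) : betaj k α j ^ 2 = k ^ 2 - (alphaj α j : ℂ) ^ 2 := by
  have := Complex.cpow_nat_inv_pow (k ^ 2 - (alphaj α j : ℂ) ^ 2) (n := 2) two_ne_zero
  simpa only [betaj, one_div, Nat.cast_ofNat] using this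

lemma betaj_ne_zero {k : ℂ} {α : ℝ} (hkα : ∀ j : ℤ, k ^ 2 ≠ (alphaj α j : ℂ) ^ 2) (j : ℤ) :
    betaj k α j ≠ 0 := by
  intro h
  have := betaj_sq k α j
  rw [h] at this
  exact hkα j (sub_eq_zero.mp (by simpa using this.symm))

/-- The radicand has argument in `[0, π]`; the principal root halves it, so its sine is nonnegative.
-/
lemma betaj_im_nonneg {k : ℂ} (hk_re : 0 ≤ k.re) (hk_im : 0 ≤ k.im) (α : ℝ) (j : ℤ) :
    0 ≤ (betaj k α j).im := by
  have him : 0 ≤ (k ^ 2 - (alphaj α j : ℂ) ^ 2).im := by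
    simp [pow_two]; positivity
  unfold betaj
  set w := k ^ 2 - (alphaj α j : ℂ) ^ 2 with hw
  have harg := Complex.arg_nonneg_iff.mpr him
  have harg' := Complex.arg_le_pi w
  by_cases h0 : w = 0
  · simp [h0]
  · rw [Complex.cpow_def_of_ne_zero h0, Complex.exp_im]
    refine mul_nonneg (Real.exp_pos _).le (Real.sin_nonneg_of_nonneg_of_le_pi ?_ ?_)
    · simp [Complex.mul_im, Complex.log_im, harg]
    · simp [Complex.mul_im, Complex.log_im]; linarith [Real.pi_pos]

/-- The frequency weight `1 + |α_j|`. -/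
noncomputable def weight (α : ℝ) (j : ℤ) : ℝ := 1 + |alphaj α j|

lemma one_le_weight (α : ℝ) (j : ℤ) : 1 ≤ weight α j := by
  unfold weight; linarith [abs_nonneg (alphaj α j)]

lemma weight_pos (α : ℝ) (j : ℤ) : 0 < weight α j := zero_lt_one.trans_le (one_le_weight α j)

lemma abs_alphaj_le_weight (α : ℝ) (j : ℤ) : |alphaj α j| ≤ weight α j := by
  unfold weight; linarith

lemma norm_betaj_sq_le (k : ℂ) (α : ℝ) (j : ℤ) :
    ‖betaj k α j‖ ^ 2 ≤ (‖k‖ ^ 2 + 1) * weight α j ^ 2 := by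
  rw [← norm_pow, betaj_sq]
  refine (norm_sub_le _ _).trans ?_
  have h1 := one_le_weight α j
  have h2 := abs_alphaj_le_weight α j
  have h3 : |alphaj α j| ^ 2 ≤ weight α j ^ 2 := by gcongr
  have h4 : 1 ≤ weight α j ^ 2 := one_le_pow₀ h1
  simp only [norm_pow, Complex.norm_real, Real.norm_eq_abs]
  nlinarith [sq_nonneg ‖k‖]

/-- The real part of `β_j² = k² - α_j²` gives `(Im β_j)² ≥ α_j² - |k|²`, and this dominates `(|α_j|
- |k|)²` as soon as `|α_j| ≥ |k|`. -/
lemma abs_alphaj_sub_norm_le_im_betaj {k : ℂ} (hk_re : 0 ≤ k.re) (hk_im : 0 ≤ k.im) (α : ℝ)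
    (j : ℤ) : |alphaj α j| - ‖k‖ ≤ (betaj k α j).im := by
  have h0 := betaj_im_nonneg hk_re hk_im α j
  have h1 := congrArg Complex.re (betaj_sq k α j)
  have h2 : ‖k‖ ^ 2 = k.re ^ 2 + k.im ^ 2 := by
    rw [← Complex.normSq_eq_norm_sq, Complex.normSq_apply]; ring
  simp [pow_two] at h1
  by_contra! h
  have h3 : (betaj k α j).im ^ 2 < (|alphaj α j| - ‖k‖) ^ 2 := by gcongr
  have h4 := sq_abs (alphaj α j)
  nlinarith [norm_nonneg k, sq_nonneg (betaj k α j).re, sq_nonneg k.im]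

lemma tendsto_abs_alphaj (α : ℝ) :
    Filter.Tendsto (fun j : ℤ => |alphaj α j|) Filter.cofinite Filter.atTop := by
  have h : Filter.Tendsto (fun j : ℤ => |(j : ℝ)|) Filter.cofinite Filter.atTop := by
    have := tendsto_norm_cocompact_atTop.comp Int.tendsto_coe_cofinite
    simpa [Function.comp_def] using this
  refine Filter.tendsto_atTop_mono (fun j => ?_) (Filter.tendsto_atTop_add_const_right _ (-|α|) h)
  have := abs_sub_abs_le_abs_sub (j : ℝ) (-α)
  simp only [abs_neg, sub_neg_eq_add] at this
  unfold alphaj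
  linarith

/-- For large `|α_j|` the bound on `Im β_j` suffices; the finitely many remaining `β_j` are nonzero
by the assumption on `k²`, so a minimum works. -/
lemma exists_weight_le_norm_betaj {k : ℂ} (hk_re : 0 ≤ k.re) (hk_im : 0 ≤ k.im) {α : ℝ}
    (hkα : ∀ j : ℤ, k ^ 2 ≠ (alphaj α j : ℂ) ^ 2) :
    ∃ c : ℝ, 0 < c ∧ ∀ j : ℤ, c * weight α j ≤ ‖betaj k α j‖ := by
  have hev : ∀ᶠ j : ℤ in Filter.cofinite, 2 * ‖k‖ + 1 ≤ |alphaj α j| :=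
    (tendsto_abs_alphaj α).eventually_ge_atTop _
  have hfin : {j : ℤ | ¬ (2 * ‖k‖ + 1 ≤ |alphaj α j|)}.Finite := hev
  obtain ⟨c, hc, hcj⟩ : ∃ c : ℝ, 0 < c ∧ ∀ j ∈ hfin.toFinset,
      c ≤ ‖betaj k α j‖ / weight α j := by
    generalize hfin.toFinset = s
    induction s using Finset.induction_on with
    | empty => exact ⟨1, one_pos, by simp⟩
    | insert a s _ ih =>
      obtain ⟨c, hc, h⟩ := ih
      refine ⟨min c (‖betaj k α a‖ / weight α a), lt_min hc
        (div_pos (norm_pos_iff.mpr (betaj_ne_zero hkα a)) (weight_pos α a)), fun j hj => ?_⟩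
      rcases Finset.mem_insert.mp hj with rfl | hj
      · exact min_le_right _ _
      · exact (min_le_left _ _).trans (h j hj)
  refine ⟨min c (1 / 4), by positivity, fun j => ?_⟩
  have hw := weight_pos α j
  by_cases hj : 2 * ‖k‖ + 1 ≤ |alphaj α j|
  · have h1 := abs_alphaj_sub_norm_le_im_betaj hk_re hk_im α j
    have h2 := (le_abs_self _).trans (Complex.abs_im_le_norm (betaj k α j))
    have h3 : min c (1 / 4) * weight α j ≤ 1 / 4 * weight α j := by
      gcongr; exact min_le_right _ _
    have h4 : weight α j = 1 + |alphaj α j| := rfl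
    linarith [norm_nonneg k]
  · have h1 := hcj j (by simpa using hj)
    rw [le_div_iff₀ hw] at h1
    refine le_trans ?_ h1
    gcongr; exact min_le_left _ _

lemma summable_weight_rpow (α : ℝ) : Summable fun j : ℤ => weight α j ^ (-(3 / 2) : ℝ) := by
  have h := (Real.summable_one_div_int_add_rpow α (3 / 2)).mpr (by norm_num)
  refine h.of_norm_bounded_eventually ?_
  filter_upwards [(tendsto_abs_alphaj α).eventually_ge_atTop 1] with j hj
  have hw := weight_pos α j
  rw [Real.norm_of_nonneg (by positivity), Real.rpow_neg hw.le, ← one_div]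
  have : |(j : ℝ) + α| ≤ weight α j := abs_alphaj_le_weight α j
  have h1 : (1 : ℝ) ≤ |(j : ℝ) + α| := hj
  gcongr

/-- `Im β_j` may vanish for some `j`, so decay at rate `weight α j` for every `j` is only available
for bounded `t`; the prefactor pays for the defect `1 + ‖k‖` in the rate. -/
lemma norm_exp_betaj_le {k : ℂ} (hk_re : 0 ≤ k.re) (hk_im : 0 ≤ k.im) (α : ℝ) (j : ℤ)
    {t T : ℝ} (ht : |t| ≤ T) :
    ‖Complex.exp (Complex.I * betaj k α j * ((|t| : ℝ) : ℂ))‖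
      ≤ Real.exp ((1 + ‖k‖) * T) * Real.exp (-(weight α j * |t|)) := by
  rw [Complex.norm_exp, ← Real.exp_add, Real.exp_le_exp]
  have h1 := abs_alphaj_sub_norm_le_im_betaj hk_re hk_im α j
  have h2 : (Complex.I * betaj k α j * ((|t| : ℝ) : ℂ)).re = -((betaj k α j).im * |t|) := by
    simp [Complex.mul_re]
  have h3 : (1 + ‖k‖) * |t| ≤ (1 + ‖k‖) * T := by gcongr
  have h4 : (|alphaj α j| - ‖k‖) * |t| ≤ (betaj k α j).im * |t| := by gcongr
  rw [h2, weight]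
  nlinarith

lemma norm_exp_betaj_le_one {k : ℂ} (hk_re : 0 ≤ k.re) (hk_im : 0 ≤ k.im) (α : ℝ) (j : ℤ)
    (t : ℝ) : ‖Complex.exp (Complex.I * betaj k α j * ((|t| : ℝ) : ℂ))‖ ≤ 1 := by
  rw [Complex.norm_exp, Real.exp_le_one_iff]
  have := mul_nonneg (betaj_im_nonneg hk_re hk_im α j) (abs_nonneg t)
  simpa [Complex.mul_re] using this

/-! ### Schur's test on the line -/

lemma lintegral_exp_neg_mul_abs {a : ℝ} (ha : 0 < a) :
    ∫⁻ t : ℝ, ENNReal.ofReal (Real.exp (-(a * |t|))) = ENNReal.ofReal (2 / a) := by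
  have h : ∫ t : ℝ, Real.exp (-(a * |t|)) = 2 / a := by
    rw [integral_comp_abs (f := fun t => Real.exp (-(a * t)))]
    have := integral_exp_mul_Ioi (neg_lt_zero.mpr ha) 0
    simp only [neg_mul, mul_zero, Real.exp_zero] at this
    rw [this]
    field_simp
  -- A non-integrable function would have Bochner integral `0`, contradicting the value just
  -- computed.
  have hi : Integrable fun t : ℝ => Real.exp (-(a * |t|)) := by
    by_contra hn
    rw [integral_undef hn] at h
    exact (by positivity : 2 / a ≠ 0) h.symm
  rw [← ofReal_integral_eq_lintegral_ofReal hi (Filter.Eventually.of_forall fun t => by positivity),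
    h]

/-- Cauchy–Schwarz for the splitting `f g = f^{1/2} · (f^{1/2} g)`, that is, with respect to the
weight `f`. -/
lemma lintegral_mul_sq_le {X : Type*} [MeasurableSpace X] {μ : Measure X} {f g : X → ℝ≥0∞}
    (hf : Measurable f) (hg : Measurable g) :
    (∫⁻ x, f x * g x ∂μ) ^ 2 ≤ (∫⁻ x, f x ∂μ) * ∫⁻ x, f x * g x ^ 2 ∂μ := by
  have h := ENNReal.lintegral_mul_le_Lp_mul_Lq μ Real.HolderConjugate.two_two
    (f := fun x => f x ^ (1 / 2 : ℝ)) (g := fun x => f x ^ (1 / 2 : ℝ) * g x)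
    (by fun_prop) (by fun_prop)
  have e (a : ℝ≥0∞) : a ^ (1 / 2 : ℝ) * a ^ (1 / 2 : ℝ) = a := by
    rw [← ENNReal.rpow_add_of_nonneg _ _ (by norm_num) (by norm_num)]; norm_num
  have e' (a : ℝ≥0∞) : (a ^ (1 / 2 : ℝ)) ^ 2 = a := by rw [pow_two, e]
  simp only [Pi.mul_apply, ← mul_assoc, e, ENNReal.rpow_two, mul_pow, e'] at h
  calc (∫⁻ x, f x * g x ∂μ) ^ 2
      ≤ ((∫⁻ x, f x ∂μ) ^ (1 / 2 : ℝ) * (∫⁻ x, f x * g x ^ 2 ∂μ) ^ (1 / 2 : ℝ)) ^ 2 := by gcongr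
    _ = _ := by rw [mul_pow, e', e']

/-- Young's inequality `L¹ * L² → L²`: weighted Cauchy–Schwarz in `y`, then Tonelli and translation
invariance. -/
lemma lintegral_sq_lintegral_sub_mul_le {κ h : ℝ → ℝ≥0∞} (hκ : Measurable κ) (hh : Measurable h) :
    ∫⁻ x, (∫⁻ y, κ (x - y) * h y) ^ 2 ≤ (∫⁻ t, κ t) ^ 2 * ∫⁻ y, h y ^ 2 := by
  calc ∫⁻ x, (∫⁻ y, κ (x - y) * h y) ^ 2
      ≤ ∫⁻ x, (∫⁻ t, κ t) * ∫⁻ y, κ (x - y) * h y ^ 2 := by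
        refine lintegral_mono fun x => ?_
        refine (lintegral_mul_sq_le (by fun_prop) hh).trans_eq ?_
        rw [lintegral_sub_left_eq_self κ x]
    _ = (∫⁻ t, κ t) * ∫⁻ y, ∫⁻ x, κ (x - y) * h y ^ 2 := by
        rw [lintegral_const_mul _ (by fun_prop), lintegral_lintegral_swap (by fun_prop)]
    _ = (∫⁻ t, κ t) ^ 2 * ∫⁻ y, h y ^ 2 := by
        have (y : ℝ) : ∫⁻ x, κ (x - y) * h y ^ 2 = (∫⁻ t, κ t) * h y ^ 2 := by
          rw [lintegral_mul_const _ (by fun_prop), lintegral_sub_right_eq_self κ y]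
        simp_rw [this]
        rw [lintegral_const_mul _ (by fun_prop), pow_two, mul_assoc]

/-- An `L²` bound for a convolution with an exponentially decaying kernel, the convolved function
living on `(-ρ, ρ)` and the result being observed on `(-R, R)`. -/
lemma lintegral_enorm_sq_conv_le {κ h : ℝ → ℂ} {A a R ρ : ℝ} (ha : 0 < a) (hA : 0 ≤ A)
    (hh : Measurable h) (hsupp : ∀ y, ρ ≤ |y| → h y = 0)
    (hκ : ∀ t, |t| ≤ R + ρ → ‖κ t‖ ≤ A * Real.exp (-(a * |t|))) :
    ∫⁻ x in Set.Ioo (-R) R, ‖∫ y, κ (x - y) * h y‖ₑ ^ 2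
      ≤ ENNReal.ofReal (2 * A / a) ^ 2 * ∫⁻ y, ‖h y‖ₑ ^ 2 := by
  -- The majorant lives on the whole line, but it is compared with `κ` only at `x - y` with `|x| <
  -- R` and `|y| < ρ`, where `hκ` applies.
  set κ' : ℝ → ℝ≥0∞ := fun t => ENNReal.ofReal A * ENNReal.ofReal (Real.exp (-(a * |t|))) with hκ'
  have hm : Measurable κ' := by fun_prop
  have hint : ∫⁻ t, κ' t = ENNReal.ofReal (2 * A / a) := by
    rw [lintegral_const_mul _ (by fun_prop), lintegral_exp_neg_mul_abs ha,
      ← ENNReal.ofReal_mul hA]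
    congr 1; ring
  calc _ ≤ ∫⁻ x in Set.Ioo (-R) R, (∫⁻ y, κ' (x - y) * ‖h y‖ₑ) ^ 2 := by
        refine setLIntegral_mono (by fun_prop) fun x hx => ?_
        gcongr
        refine (enorm_integral_le_lintegral_enorm _).trans (lintegral_mono fun y => ?_)
        rcases le_or_gt ρ |y| with hy | hy
        · simp [hsupp y hy]
        · rw [enorm_mul]
          gcongr
          have h1 : |x - y| ≤ R + ρ := by
            have := abs_sub x y
            have := abs_lt.mpr hx
            linarith
          simp only [hκ']
          rw [← ofReal_norm, ← ENNReal.ofReal_mul hA]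
          exact ENNReal.ofReal_le_ofReal (hκ _ h1)
    _ ≤ ∫⁻ x, (∫⁻ y, κ' (x - y) * ‖h y‖ₑ) ^ 2 := setLIntegral_le_lintegral _ _
    _ ≤ _ := by
        rw [← hint]
        exact lintegral_sq_lintegral_sub_mul_le hm (by fun_prop)

/-! ### The one-dimensional fundamental solutions -/

open Classical in
/-- A kernel solving `u' = ± b u` on the two half lines, with values `p` and `q` at `0±`. -/
noncomputable def jumpKernel (b p q : ℂ) (t : ℝ) : ℂ :=
  (if 0 < t then p else q) * Complex.exp (b * ((|t| : ℝ) : ℂ))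

lemma measurable_jumpKernel (b p q : ℂ) : Measurable (jumpKernel b p q) := by
  unfold jumpKernel
  exact (Measurable.ite measurableSet_Ioi measurable_const measurable_const).mul (by fun_prop)

lemma jumpKernel_mul (b p q c : ℂ) (t : ℝ) :
    jumpKernel b (c * p) (c * q) t = c * jumpKernel b p q t := by
  unfold jumpKernel; split_ifs <;> ring

/-- Integration by parts on the two half lines: the distributional derivative is the classical one
plus the jump `p - q` times a point mass. -/
lemma integral_jumpKernel_mul_deriv {ψ : ℝ → ℂ} (hψ : ContDiff ℝ 1 ψ) (hc : HasCompactSupport ψ)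
    (b p q : ℂ) (y : ℝ) :
    ∫ x, jumpKernel b p q (x - y) * deriv ψ x
      = (q - p) * ψ y - ∫ x, jumpKernel b (p * b) (-(q * b)) (x - y) * ψ x := by
  have hψ' : Continuous (deriv ψ) := hψ.continuous_deriv le_rfl
  have int (c : ℂ) {χ : ℝ → ℂ} (hχ : Continuous χ) (hc' : HasCompactSupport χ) :
      Integrable fun x : ℝ => Complex.exp (c * ((x : ℂ) - y)) * χ x :=
    Continuous.integrable_of_hasCompactSupport (by fun_prop) hc'.mul_left
  have der (c : ℂ) (x : ℝ) : deriv (fun x : ℝ => Complex.exp (c * ((x : ℂ) - y)) * ψ x) x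
      = c * (Complex.exp (c * ((x : ℂ) - y)) * ψ x)
        + Complex.exp (c * ((x : ℂ) - y)) * deriv ψ x := by
    have h1 : HasDerivAt (fun x : ℝ => Complex.exp (c * ((x : ℂ) - y)))
        (Complex.exp (c * ((x : ℂ) - y)) * (c * 1)) x :=
      (((Complex.ofRealCLM.hasDerivAt (x := x)).sub_const (y : ℂ)).const_mul c).cexp
    refine (h1.mul (hψ.differentiable one_ne_zero x).hasDerivAt).deriv.trans ?_
    ring
  have smooth (c : ℂ) : ContDiff ℝ 1 fun x : ℝ => Complex.exp (c * ((x : ℂ) - y)) * ψ x := by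
    have : ContDiff ℝ 1 (fun x : ℝ => (x : ℂ)) := Complex.ofRealCLM.contDiff
    exact (ContDiff.cexp (contDiff_const.mul (this.sub contDiff_const))).mul hψ
  have right := HasCompactSupport.integral_Ioi_deriv_eq (smooth b)
    (hc.mul_left (f := fun x : ℝ => Complex.exp (b * ((x : ℂ) - y)))) y
  have left := HasCompactSupport.integral_Iic_deriv_eq (smooth (-b))
    (hc.mul_left (f := fun x : ℝ => Complex.exp (-b * ((x : ℂ) - y)))) y
  simp only [der, sub_self, mul_zero, Complex.exp_zero, one_mul] at right left
  rw [integral_add ((int _ hψ.continuous hc).const_mul _).integrableOn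
    (int _ hψ' hc.deriv).integrableOn, integral_const_mul] at right left
  have split (p q : ℂ) {χ : ℝ → ℂ} (hχ : Continuous χ) (hc' : HasCompactSupport χ) :
      ∫ x, jumpKernel b p q (x - y) * χ x
        = p * (∫ x in Set.Ioi y, Complex.exp (b * ((x : ℂ) - y)) * χ x)
          + q * ∫ x in Set.Iic y, Complex.exp (-b * ((x : ℂ) - y)) * χ x := by
    have e1 : Set.EqOn (fun x => jumpKernel b p q (x - y) * χ x)
        (fun x : ℝ => p * (Complex.exp (b * ((x : ℂ) - y)) * χ x)) (Set.Ioi y) := by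
      intro x (hx : y < x)
      simp only [jumpKernel, if_pos (sub_pos.mpr hx), abs_of_pos (sub_pos.mpr hx)]
      push_cast; ring
    have e2 : Set.EqOn (fun x => jumpKernel b p q (x - y) * χ x)
        (fun x : ℝ => q * (Complex.exp (-b * ((x : ℂ) - y)) * χ x)) (Set.Iic y) := by
      intro x (hx : x ≤ y)
      simp only [jumpKernel, if_neg (not_lt.mpr (sub_nonpos.mpr hx)),
        abs_of_nonpos (sub_nonpos.mpr hx)]
      push_cast; ring_nf
    have i1 := (integrableOn_congr_fun e1 measurableSet_Ioi).mpr
      ((int b hχ hc').const_mul p).integrableOn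
    have i2 := (integrableOn_congr_fun e2 measurableSet_Iic).mpr
      ((int (-b) hχ hc').const_mul q).integrableOn
    have := setIntegral_union (Set.Iic_disjoint_Ioi le_rfl).symm measurableSet_Iic i1 i2
    rw [Set.union_comm, Set.Iic_union_Ioi, setIntegral_univ] at this
    rw [this, setIntegral_congr_fun measurableSet_Ioi e1, setIntegral_congr_fun measurableSet_Iic e2,
      integral_const_mul, integral_const_mul]
  rw [split p q hψ' hc.deriv, split _ _ hψ.continuous hc]
  linear_combination p * right + q * left

/-- The fundamental solution of `u'' + β_j² u = -(2π)⁻¹ δ`. -/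
noncomputable def modeKernel (k : ℂ) (α : ℝ) (j : ℤ) : ℝ → ℂ :=
  jumpKernel (Complex.I * betaj k α j) (Complex.I / (4 * (Real.pi : ℂ)) * (1 / betaj k α j))
    (Complex.I / (4 * (Real.pi : ℂ)) * (1 / betaj k α j))

/-- The derivative of `modeKernel`. -/
noncomputable def modeKernelDeriv (k : ℂ) (α : ℝ) (j : ℤ) : ℝ → ℂ :=
  jumpKernel (Complex.I * betaj k α j) (-1 / (4 * (Real.pi : ℂ))) (1 / (4 * (Real.pi : ℂ)))

lemma modeKernel_eq (k : ℂ) (α : ℝ) (j : ℤ) (t : ℝ) :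
    modeKernel k α j t = Complex.I / (4 * (Real.pi : ℂ)) * (1 / betaj k α j *
      Complex.exp (Complex.I * betaj k α j * ((|t| : ℝ) : ℂ))) := by
  simp only [modeKernel, jumpKernel, ite_self, mul_assoc]

lemma norm_modeKernel (k : ℂ) (α : ℝ) (j : ℤ) (t : ℝ) :
    ‖modeKernel k α j t‖ = 1 / (4 * Real.pi) / ‖betaj k α j‖ *
      ‖Complex.exp (Complex.I * betaj k α j * ((|t| : ℝ) : ℂ))‖ := by
  simp only [modeKernel_eq, norm_mul, norm_div, Complex.norm_I, norm_one, Complex.norm_real,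
    Real.norm_of_nonneg Real.pi_pos.le, Complex.norm_ofNat]
  ring

lemma norm_modeKernelDeriv (k : ℂ) (α : ℝ) (j : ℤ) (t : ℝ) :
    ‖modeKernelDeriv k α j t‖ = 1 / (4 * Real.pi) *
      ‖Complex.exp (Complex.I * betaj k α j * ((|t| : ℝ) : ℂ))‖ := by
  unfold modeKernelDeriv jumpKernel
  split_ifs <;> simp [abs_of_nonneg Real.pi_pos.le]

lemma integral_modeKernel_mul_deriv {k : ℂ} {α : ℝ} {j : ℤ} (hβ : betaj k α j ≠ 0)
    {ψ : ℝ → ℂ} (hψ : ContDiff ℝ 1 ψ) (hc : HasCompactSupport ψ) (y : ℝ) :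
    ∫ x, modeKernel k α j (x - y) * deriv ψ x = -∫ x, modeKernelDeriv k α j (x - y) * ψ x := by
  have hπ : (Real.pi : ℂ) ≠ 0 := by exact_mod_cast Real.pi_ne_zero
  rw [modeKernel, integral_jumpKernel_mul_deriv hψ hc, sub_self, zero_mul, zero_sub,
    modeKernelDeriv]
  have e : Complex.I / (4 * (Real.pi : ℂ)) * (1 / betaj k α j) * (Complex.I * betaj k α j)
      = -1 / (4 * (Real.pi : ℂ)) := by
    field_simp; exact Complex.I_sq
  rw [e, neg_div, neg_neg]

/-- The jump of `modeKernelDeriv` at `0` is `-1/(2π)`, which produces the point evaluation; away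
from `0` its derivative is `-β_j²` times `modeKernel`. -/
lemma integral_modeKernelDeriv_mul_deriv {k : ℂ} {α : ℝ} {j : ℤ} (hβ : betaj k α j ≠ 0)
    {ψ : ℝ → ℂ} (hψ : ContDiff ℝ 1 ψ) (hc : HasCompactSupport ψ) (y : ℝ) :
    ∫ x, modeKernelDeriv k α j (x - y) * deriv ψ x
      = 1 / (2 * (Real.pi : ℂ)) * ψ y
        + betaj k α j ^ 2 * ∫ x, modeKernel k α j (x - y) * ψ x := by
  have hπ : (Real.pi : ℂ) ≠ 0 := by exact_mod_cast Real.pi_ne_zero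
  rw [modeKernelDeriv, integral_jumpKernel_mul_deriv hψ hc, modeKernel, ← integral_const_mul]
  have e : -1 / (4 * (Real.pi : ℂ)) * (Complex.I * betaj k α j)
      = -betaj k α j ^ 2 * (Complex.I / (4 * (Real.pi : ℂ)) * (1 / betaj k α j)) := by
    field_simp
  have e' : -(1 / (4 * (Real.pi : ℂ)) * (Complex.I * betaj k α j))
      = -betaj k α j ^ 2 * (Complex.I / (4 * (Real.pi : ℂ)) * (1 / betaj k α j)) := by
    rw [← e]; ring
  rw [e, e', sub_eq_add_neg, ← integral_neg]
  congr 1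
  · ring
  · refine integral_congr_ae (Filter.Eventually.of_forall fun x => ?_)
    simp only [jumpKernel_mul]
    ring

/-! ### Fourier coefficients of the density -/

/-- A square integrable density on the plane that vanishes outside `Ω_ρ`. -/
structure IsDensity (ρ : ℝ) (F : ℝ × ℝ → ℂ) : Prop where
  measurable : Measurable F
  eq_zero : ∀ y, y ∉ cell ρ → F y = 0
  lintegral_sq_lt_top : ∫⁻ y, ‖F y‖ₑ ^ 2 < ⊤

lemma volume_cell_lt_top (R : ℝ) : volume (cell R) < ⊤ :=
  ((Metric.isBounded_Ioo _ _).prod (Metric.isBounded_Ioo _ _)).measure_lt_top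

lemma memLp_two_of_lintegral_sq_lt_top {X : Type*} [MeasurableSpace X] {μ : Measure X} {f : X → ℂ}
    (hf : AEStronglyMeasurable f μ) (h : ∫⁻ x, ‖f x‖ₑ ^ 2 ∂μ < ⊤) : MemLp f 2 μ := by
  refine ⟨hf, (eLpNorm_lt_top_iff_lintegral_rpow_enorm_lt_top two_ne_zero ENNReal.ofNat_ne_top).mpr ?_⟩
  simpa using h

lemma eLpNorm_two_sq {X : Type*} [MeasurableSpace X] (μ : Measure X) (f : X → ℂ) :
    eLpNorm f 2 μ ^ 2 = ∫⁻ x, ‖f x‖ₑ ^ 2 ∂μ := by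
  have := eLpNorm_nnreal_pow_eq_lintegral (f := f) (μ := μ) (p := 2) two_ne_zero
  simpa using this

namespace IsDensity

variable {ρ : ℝ} {F : ℝ × ℝ → ℂ}

lemma integrable (hF : IsDensity ρ F) : Integrable F := by
  have h1 : MemLp F 2 (volume.restrict (cell ρ)) :=
    (memLp_two_of_lintegral_sq_lt_top hF.measurable.aestronglyMeasurable
      hF.lintegral_sq_lt_top).restrict _
  have : IsFiniteMeasure (volume.restrict (cell ρ)) := ⟨by simpa using volume_cell_lt_top ρ⟩
  have h2 : IntegrableOn F (cell ρ) := h1.integrable one_le_two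
  exact h2.integrable_of_forall_notMem_eq_zero hF.eq_zero

end IsDensity

/-- The Fourier coefficients `∫ exp(-i α_j y₁) F(y₁, y₂) dy₁`. -/
noncomputable def coeff (α : ℝ) (F : ℝ × ℝ → ℂ) (j : ℤ) (y₂ : ℝ) : ℂ :=
  ∫ y₁ : ℝ, Complex.exp (-(Complex.I * (alphaj α j : ℂ) * (y₁ : ℂ))) * F (y₁, y₂)

lemma IsDensity.coeff_eq_zero {ρ : ℝ} {F : ℝ × ℝ → ℂ} (hF : IsDensity ρ F) (α : ℝ) (j : ℤ) {y₂ : ℝ}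
    (hy : ρ ≤ |y₂|) : coeff α F j y₂ = 0 := by
  unfold coeff
  have (y₁ : ℝ) : F (y₁, y₂) = 0 := hF.eq_zero _ fun h => (abs_lt.mpr h.2).not_ge hy
  simp [this]

lemma IsDensity.measurable_coeff {ρ : ℝ} {F : ℝ × ℝ → ℂ} (hF : IsDensity ρ F) (α : ℝ) (j : ℤ) :
    Measurable (coeff α F j) := by
  have := hF.measurable
  have h : Measurable fun y : ℝ × ℝ =>
    Complex.exp (-(Complex.I * (alphaj α j : ℂ) * (y.1 : ℂ))) * F y := by fun_prop
  exact h.stronglyMeasurable.integral_prod_left'.measurable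

lemma norm_exp_I_mul_ofReal_mul_ofReal (a b : ℝ) :
    ‖Complex.exp (Complex.I * (a : ℂ) * (b : ℂ))‖ = 1 := by
  rw [mul_assoc, mul_comm, ← Complex.ofReal_mul]; exact Complex.norm_exp_ofReal_mul_I _

lemma norm_exp_neg_I_mul_ofReal_mul_ofReal (a b : ℝ) :
    ‖Complex.exp (-(Complex.I * (a : ℂ) * (b : ℂ)))‖ = 1 := by
  rw [Complex.exp_neg, norm_inv, norm_exp_I_mul_ofReal_mul_ofReal, inv_one]

lemma IsDensity.integrable_exp_mul {ρ : ℝ} {F : ℝ × ℝ → ℂ} (hF : IsDensity ρ F) (a : ℝ) :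
    Integrable fun y : ℝ × ℝ => Complex.exp (-(Complex.I * (a : ℂ) * (y.1 : ℂ))) * F y :=
  hF.integrable.bdd_mul (c := 1) (by fun_prop)
    (Filter.Eventually.of_forall fun y => (norm_exp_neg_I_mul_ofReal_mul_ofReal _ _).le)

lemma IsDensity.integrable_coeff {ρ : ℝ} {F : ℝ × ℝ → ℂ} (hF : IsDensity ρ F) (α : ℝ) (j : ℤ) :
    Integrable (coeff α F j) :=
  (hF.integrable_exp_mul (alphaj α j)).integral_prod_right

/-- **Bessel's inequality** for quasi-periodic Fourier coefficients on `(-π, π)`. -/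
lemma tsum_enorm_integral_exp_sq_le (α : ℝ) {h : ℝ → ℂ} (hm : Measurable h)
    (h0 : ∀ y, y ∉ Set.Ioo (-Real.pi) Real.pi → h y = 0) :
    ∑' j : ℤ, ‖∫ y : ℝ, Complex.exp (-(Complex.I * (alphaj α j : ℂ) * (y : ℂ))) * h y‖ₑ ^ 2
      ≤ ENNReal.ofReal (2 * Real.pi) * ∫⁻ y, ‖h y‖ₑ ^ 2 := by
  have hπ := Real.pi_pos
  by_cases htop : ∫⁻ y, ‖h y‖ₑ ^ 2 = ⊤
  · rw [htop, ENNReal.mul_top (by simp [hπ])]; exact le_top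
  -- The twist by `exp(-iαy)` turns the quasi-periodic coefficients into ordinary ones, for which
  -- Parseval is available.
  set g : ℝ → ℂ := fun y => Complex.exp (-(Complex.I * (α : ℂ) * (y : ℂ))) * h y with hg
  have hgn (y : ℝ) : ‖g y‖ = ‖h y‖ := by
    simp only [hg, norm_mul, norm_exp_neg_I_mul_ofReal_mul_ofReal, one_mul]
  have hge (y : ℝ) : ‖g y‖ₑ = ‖h y‖ₑ := by rw [← ofReal_norm, hgn, ofReal_norm]
  have hgm : MemLp g 2 volume := by
    refine memLp_two_of_lintegral_sq_lt_top (by fun_prop) ?_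
    simp_rw [hge]; exact lt_top_iff_ne_top.mpr htop
  have hab : -Real.pi < Real.pi := by linarith
  have hP := hasSum_sq_fourierCoeffOn hab (hgm.restrict _)
  have hg0 (y : ℝ) (hy : y ∉ Set.Ioc (-Real.pi) Real.pi) : h y = 0 :=
    h0 y fun h => hy (Set.Ioo_subset_Ioc_self h)
  have hc (j : ℤ) : ∫ y : ℝ, Complex.exp (-(Complex.I * (alphaj α j : ℂ) * (y : ℂ))) * h y
      = (2 * Real.pi : ℝ) • fourierCoeffOn hab g j := by
    rw [fourierCoeffOn_eq_integral, intervalIntegral.integral_of_le hab.le,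
      setIntegral_eq_integral_of_forall_compl_eq_zero]
    · have : Real.pi - -Real.pi = 2 * Real.pi := by ring
      rw [smul_smul, this, mul_one_div_cancel (by positivity), one_smul]
      refine integral_congr_ae (Filter.Eventually.of_forall fun y => ?_)
      simp only [fourier_coe_apply, hg, smul_eq_mul, ← mul_assoc, ← Complex.exp_add]
      congr 2
      have : (Real.pi : ℂ) ≠ 0 := by exact_mod_cast hπ.ne'
      unfold alphaj
      push_cast
      field_simp
      ring
    · intro y hy; simp [hg, hg0 y hy]
  have hI : ∫ y in (-Real.pi)..Real.pi, ‖g y‖ ^ 2 = ∫ y, ‖g y‖ ^ 2 := by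
    rw [intervalIntegral.integral_of_le hab.le, setIntegral_eq_integral_of_forall_compl_eq_zero]
    intro y hy; simp [hg, hg0 y hy]
  have hE : ENNReal.ofReal (∫ y, ‖g y‖ ^ 2) = ∫⁻ y, ‖h y‖ₑ ^ 2 := by
    rw [ofReal_integral_eq_lintegral_ofReal (hgm.integrable_norm_pow two_ne_zero)
      (Filter.Eventually.of_forall fun y => by positivity)]
    simp_rw [ENNReal.ofReal_pow (norm_nonneg _), ofReal_norm, hge]
  have hsum : HasSum (fun j : ℤ => ‖∫ y : ℝ,
      Complex.exp (-(Complex.I * (alphaj α j : ℂ) * (y : ℂ))) * h y‖ ^ 2)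
      (2 * Real.pi * ∫ y, ‖g y‖ ^ 2) := by
    -- The integrals here are `2π` times the normalised coefficients, so Parseval's factor `1/(2π)`
    -- becomes `2π`.
    have := hP.mul_left ((2 * Real.pi) ^ 2)
    rw [hI, smul_eq_mul, ← mul_assoc] at this
    have e : (2 * Real.pi) ^ 2 * (Real.pi - -Real.pi)⁻¹ = 2 * Real.pi := by
      rw [sub_neg_eq_add, ← two_mul]; field_simp
    rw [e] at this
    refine this.congr_fun fun j => ?_
    rw [hc, norm_smul, mul_pow, Real.norm_of_nonneg (by positivity)]
  have := ENNReal.ofReal_tsum_of_nonneg (fun j => by positivity) hsum.summable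
  rw [hsum.tsum_eq, ENNReal.ofReal_mul (by positivity), hE] at this
  rw [this]
  simp_rw [ENNReal.ofReal_pow (norm_nonneg _), ofReal_norm, le_rfl]

/-- Bessel's inequality on each horizontal slice, integrated over `y₂`. -/
lemma IsDensity.tsum_lintegral_coeff_sq_le {ρ : ℝ} {F : ℝ × ℝ → ℂ} (hF : IsDensity ρ F) (α : ℝ) :
    ∑' j : ℤ, ∫⁻ y, ‖coeff α F j y‖ₑ ^ 2 ≤ ENNReal.ofReal (2 * Real.pi) * ∫⁻ y, ‖F y‖ₑ ^ 2 := by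
  have hm := hF.measurable
  have hcm := hF.measurable_coeff α
  rw [← lintegral_tsum fun j => by have := hcm j; fun_prop]
  calc _ ≤ ∫⁻ y₂, ENNReal.ofReal (2 * Real.pi) * ∫⁻ y₁, ‖F (y₁, y₂)‖ₑ ^ 2 :=
        lintegral_mono fun y₂ => tsum_enorm_integral_exp_sq_le α (by fun_prop)
          fun y₁ hy => hF.eq_zero _ fun h => hy h.1
    _ = _ := by
        rw [lintegral_const_mul _ (by fun_prop), Measure.volume_eq_prod, lintegral_prod_symm _ (by fun_prop)]

/-! ### The Fourier modes of the potential -/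

/-- The `x₂`-profile of the `j`-th Fourier mode of the potential (`n = 0`) and its first two
derivatives. -/
noncomputable def profile (k : ℂ) (α : ℝ) (F : ℝ × ℝ → ℂ) (j : ℤ) : ℕ → ℝ → ℂ
  | 0 => fun x => ∫ y, modeKernel k α j (x - y) * coeff α F j y
  | 1 => fun x => ∫ y, modeKernelDeriv k α j (x - y) * coeff α F j y
  -- The second derivative is read off from the differential equation; the catch-all is meant for `n
  -- = 2`.
  | _ => fun x => -betaj k α j ^ 2 * (∫ y, modeKernel k α j (x - y) * coeff α F j y)
      - 1 / (2 * (Real.pi : ℂ)) * coeff α F j x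

lemma measurable_integral_sub_mul {κ h : ℝ → ℂ} (hκ : Measurable κ) (hh : Measurable h) :
    Measurable fun x => ∫ y, κ (x - y) * h y := by
  have h : Measurable fun p : ℝ × ℝ => κ (p.1 - p.2) * h p.2 := by fun_prop
  exact h.stronglyMeasurable.integral_prod_right'.measurable

lemma measurable_modeKernel (k : ℂ) (α : ℝ) (j : ℤ) : Measurable (modeKernel k α j) :=
  measurable_jumpKernel _ _ _

lemma measurable_modeKernelDeriv (k : ℂ) (α : ℝ) (j : ℤ) : Measurable (modeKernelDeriv k α j) :=
  measurable_jumpKernel _ _ _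

lemma IsDensity.measurable_profile {ρ : ℝ} {F : ℝ × ℝ → ℂ} (hF : IsDensity ρ F) (k : ℂ) (α : ℝ)
    (j : ℤ) (n : ℕ) : Measurable (profile k α F j n) := by
  have hc := hF.measurable_coeff α j
  have h0 := measurable_integral_sub_mul (measurable_modeKernel k α j) hc
  match n with
  | 0 => exact h0
  | 1 => exact measurable_integral_sub_mul (measurable_modeKernelDeriv k α j) hc
  | _ + 2 => exact (h0.const_mul _).sub (hc.const_mul _)

lemma norm_modeKernel_le {k : ℂ} (hk_re : 0 ≤ k.re) (hk_im : 0 ≤ k.im) {α c : ℝ} (hc : 0 < c)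
    {j : ℤ} (hcj : c * weight α j ≤ ‖betaj k α j‖) {t T : ℝ} (ht : |t| ≤ T) :
    ‖modeKernel k α j t‖
      ≤ Real.exp ((1 + ‖k‖) * T) / (c * weight α j) * Real.exp (-(weight α j * |t|)) := by
  have hw := weight_pos α j
  have hπ := Real.pi_gt_three
  rw [norm_modeKernel]
  calc _ ≤ 1 / (c * weight α j)
        * (Real.exp ((1 + ‖k‖) * T) * Real.exp (-(weight α j * |t|))) := by
        gcongr
        · rw [div_le_one (by positivity)]; linarith
        · exact norm_exp_betaj_le hk_re hk_im α j ht
    _ = _ := by ring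

lemma norm_modeKernelDeriv_le {k : ℂ} (hk_re : 0 ≤ k.re) (hk_im : 0 ≤ k.im) (α : ℝ)
    (j : ℤ) {t T : ℝ} (ht : |t| ≤ T) :
    ‖modeKernelDeriv k α j t‖
      ≤ Real.exp ((1 + ‖k‖) * T) * Real.exp (-(weight α j * |t|)) := by
  have hπ := Real.pi_gt_three
  rw [norm_modeKernelDeriv]
  refine (mul_le_of_le_one_left (norm_nonneg _) ?_).trans (norm_exp_betaj_le hk_re hk_im α j ht)
  rw [div_le_one (by positivity)]; linarith

lemma enorm_le_ofReal {z : ℂ} {K : ℝ} (h : ‖z‖ ≤ K) : ‖z‖ₑ ≤ ENNReal.ofReal K := by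
  rw [← ofReal_norm]; exact ENNReal.ofReal_le_ofReal h

lemma add_sq_le_two_mul_add_sq (a b : ℝ≥0∞) : (a + b) ^ 2 ≤ 2 * (a ^ 2 + b ^ 2) := by
  have := ENNReal.rpow_add_le_mul_rpow_add_rpow a b (p := 2) one_le_two
  norm_num at this
  exact this

/-- The kernel majorant has `L¹` norm of order `w⁻²`, which absorbs a multiplier `z` of size `w²`: a
power of `iα_j`, or `-β_j²`. -/
lemma IsDensity.lintegral_mul_profile_zero_sq_le {k : ℂ} (hk_re : 0 ≤ k.re) (hk_im : 0 ≤ k.im)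
    {α c : ℝ} (hc : 0 < c) {j : ℤ} (hcj : c * weight α j ≤ ‖betaj k α j‖) {ρ R : ℝ}
    {F : ℝ × ℝ → ℂ} (hF : IsDensity ρ F) {z : ℂ} {K : ℝ} (hK : 0 ≤ K)
    (hz : ‖z‖ ≤ K * weight α j ^ 2) :
    ∫⁻ x in Set.Ioo (-R) R, ‖z * profile k α F j 0 x‖ₑ ^ 2
      ≤ ENNReal.ofReal (2 * K * Real.exp ((1 + ‖k‖) * (R + ρ)) / c) ^ 2
        * ∫⁻ y, ‖coeff α F j y‖ₑ ^ 2 := by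
  have hw := weight_pos α j
  have h := lintegral_enorm_sq_conv_le (R := R) (ρ := ρ) hw (by positivity)
    (hF.measurable_coeff α j) (fun y hy => hF.coeff_eq_zero α j hy)
    (fun t ht => norm_modeKernel_le hk_re hk_im hc hcj ht)
  simp_rw [enorm_mul, mul_pow]
  rw [lintegral_const_mul _ ((hF.measurable_profile k α j 0).enorm.pow_const 2)]
  calc _ ≤ ENNReal.ofReal (K * weight α j ^ 2) ^ 2 * _ :=
        mul_le_mul' (pow_le_pow_left' (enorm_le_ofReal hz) 2) h
    _ = _ := by
        rw [← mul_assoc, ← mul_pow, ← ENNReal.ofReal_mul (by positivity)]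
        congr 3
        field_simp

lemma IsDensity.lintegral_mul_profile_one_sq_le {k : ℂ} (hk_re : 0 ≤ k.re) (hk_im : 0 ≤ k.im)
    {α : ℝ} {j : ℤ} {ρ R : ℝ} {F : ℝ × ℝ → ℂ} (hF : IsDensity ρ F) {z : ℂ}
    (hz : ‖z‖ ≤ weight α j) :
    ∫⁻ x in Set.Ioo (-R) R, ‖z * profile k α F j 1 x‖ₑ ^ 2
      ≤ ENNReal.ofReal (2 * Real.exp ((1 + ‖k‖) * (R + ρ))) ^ 2
        * ∫⁻ y, ‖coeff α F j y‖ₑ ^ 2 := by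
  have hw := weight_pos α j
  have h := lintegral_enorm_sq_conv_le (R := R) (ρ := ρ) hw (by positivity)
    (hF.measurable_coeff α j) (fun y hy => hF.coeff_eq_zero α j hy)
    (fun t ht => norm_modeKernelDeriv_le hk_re hk_im α j ht)
  simp_rw [enorm_mul, mul_pow]
  rw [lintegral_const_mul _ ((hF.measurable_profile k α j 1).enorm.pow_const 2)]
  calc _ ≤ ENNReal.ofReal (weight α j) ^ 2 * _ :=
        mul_le_mul' (pow_le_pow_left' (enorm_le_ofReal hz) 2) h
    _ = _ := by
        rw [← mul_assoc, ← mul_pow, ← ENNReal.ofReal_mul (by positivity)]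
        congr 3
        field_simp

lemma IsDensity.lintegral_profile_two_sq_le {k : ℂ} (hk_re : 0 ≤ k.re) (hk_im : 0 ≤ k.im)
    {α c : ℝ} (hc : 0 < c) {j : ℤ} (hcj : c * weight α j ≤ ‖betaj k α j‖) {ρ R : ℝ}
    {F : ℝ × ℝ → ℂ} (hF : IsDensity ρ F) :
    ∫⁻ x in Set.Ioo (-R) R, ‖profile k α F j 2 x‖ₑ ^ 2
      ≤ 2 * (ENNReal.ofReal (2 * (‖k‖ ^ 2 + 1) * Real.exp ((1 + ‖k‖) * (R + ρ)) / c) ^ 2 + 1)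
        * ∫⁻ y, ‖coeff α F j y‖ₑ ^ 2 := by
  have hm := hF.measurable_coeff α j
  have h := hF.lintegral_mul_profile_zero_sq_le (R := R) hk_re hk_im hc hcj
    (z := -betaj k α j ^ 2) (K := ‖k‖ ^ 2 + 1) (by positivity)
    (by simpa using norm_betaj_sq_le k α j)
  have hπ : ‖1 / (2 * (Real.pi : ℂ))‖ₑ ≤ 1 := by
    refine (enorm_le_ofReal (K := 1) ?_).trans (by simp)
    have := Real.pi_gt_three
    simp only [norm_div, norm_one, norm_mul, Complex.norm_ofNat, Complex.norm_real,
      Real.norm_of_nonneg Real.pi_pos.le]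
    rw [div_le_one (by positivity)]; linarith
  calc ∫⁻ x in Set.Ioo (-R) R, ‖profile k α F j 2 x‖ₑ ^ 2
      ≤ ∫⁻ x in Set.Ioo (-R) R, (2 * ‖-betaj k α j ^ 2 * profile k α F j 0 x‖ₑ ^ 2
        + 2 * ‖coeff α F j x‖ₑ ^ 2) := by
        refine lintegral_mono fun x => ?_
        rw [← mul_add]
        calc _ ≤ (‖-betaj k α j ^ 2 * profile k α F j 0 x‖ₑ + ‖coeff α F j x‖ₑ) ^ 2 := by
              refine pow_le_pow_left' ((enorm_sub_le (E := ℂ)).trans (add_le_add le_rfl ?_)) 2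
              rw [enorm_mul]
              exact mul_le_of_le_one_left' hπ
          _ ≤ _ := add_sq_le_two_mul_add_sq _ _
    _ = 2 * (∫⁻ x in Set.Ioo (-R) R, ‖-betaj k α j ^ 2 * profile k α F j 0 x‖ₑ ^ 2)
        + 2 * ∫⁻ x in Set.Ioo (-R) R, ‖coeff α F j x‖ₑ ^ 2 := by
        have := hF.measurable_profile k α j 0
        rw [lintegral_add_left (by fun_prop), lintegral_const_mul _ (by fun_prop),
          lintegral_const_mul _ (by fun_prop)]
    _ ≤ 2 * (ENNReal.ofReal (2 * (‖k‖ ^ 2 + 1) * Real.exp ((1 + ‖k‖) * (R + ρ)) / c) ^ 2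
        * ∫⁻ y, ‖coeff α F j y‖ₑ ^ 2) + 2 * ∫⁻ y, ‖coeff α F j y‖ₑ ^ 2 := by
        gcongr
        exact Measure.restrict_le_self
    _ = _ := by ring

/-- Elliptic regularity frequency by frequency: each derivative costs one power of the weight and
the kernel gains two. What matters is that `C` is independent of `j` and `F`. -/
lemma exists_lintegral_mul_profile_sq_le {k : ℂ} (hk_re : 0 ≤ k.re) (hk_im : 0 ≤ k.im) {α : ℝ}
    (hkα : ∀ j : ℤ, k ^ 2 ≠ (alphaj α j : ℂ) ^ 2) (ρ R : ℝ) :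
    ∃ C : ℝ≥0, ∀ F : ℝ × ℝ → ℂ, IsDensity ρ F → ∀ (j : ℤ) (m : ℕ × ℕ), m.1 + m.2 ≤ 2 →
      ∫⁻ x in Set.Ioo (-R) R,
          ‖(Complex.I * (alphaj α j : ℂ)) ^ m.1 * profile k α F j m.2 x‖ₑ ^ 2
        ≤ C * ∫⁻ y, ‖coeff α F j y‖ₑ ^ 2 := by
  obtain ⟨c, hc, hcj⟩ := exists_weight_le_norm_betaj hk_re hk_im hkα
  set C₀ : ℝ≥0 := Real.toNNReal (2 * 1 * Real.exp ((1 + ‖k‖) * (R + ρ)) / c) ^ 2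
  set C₁ : ℝ≥0 := Real.toNNReal (2 * Real.exp ((1 + ‖k‖) * (R + ρ))) ^ 2
  set C₂ : ℝ≥0 :=
    2 * (Real.toNNReal (2 * (‖k‖ ^ 2 + 1) * Real.exp ((1 + ‖k‖) * (R + ρ)) / c) ^ 2 + 1)
  refine ⟨C₀ + C₁ + C₂, fun F hF j m hm => ?_⟩
  have h1 := one_le_weight α j
  have hz (n : ℕ) : ‖(Complex.I * (alphaj α j : ℂ)) ^ n‖ ≤ weight α j ^ n := by
    rw [norm_pow, norm_mul, Complex.norm_I, one_mul, Complex.norm_real]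
    gcongr
    exact abs_alphaj_le_weight α j
  obtain ⟨m₁, m₂⟩ := m
  match m₂ with
  | 0 =>
    refine (hF.lintegral_mul_profile_zero_sq_le hk_re hk_im hc (hcj j) zero_le_one ?_).trans ?_
    · rw [one_mul]
      exact (hz m₁).trans (pow_le_pow_right₀ h1 (by simpa using hm))
    · gcongr
      push_cast
      exact le_add_right (le_add_right le_rfl)
  | 1 =>
    refine (hF.lintegral_mul_profile_one_sq_le hk_re hk_im ?_).trans ?_
    · exact (hz m₁).trans ((pow_le_pow_right₀ h1 (by simpa using hm)).trans_eq (pow_one _))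
    · gcongr
      push_cast
      exact le_add_right (le_add_left le_rfl)
  | 2 =>
    obtain rfl : m₁ = 0 := by simpa using hm
    simp only [pow_zero, one_mul]
    refine (hF.lintegral_profile_two_sq_le hk_re hk_im hc (hcj j)).trans ?_
    gcongr
    push_cast
    exact le_add_left le_rfl
  | n + 3 => exact absurd hm (by simp; omega)

/-! ### Orthogonal series in boxes -/

/-- The vectors need not be normalised and may vanish, so the orthogonal family consists of the
subspaces they span. -/
lemma exists_hasSum_of_pairwise_orthogonal {ι E : Type*} [NormedAddCommGroup E]
    [InnerProductSpace ℂ E] [CompleteSpace E] {V : ι → E}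
    (hV : Pairwise fun i j => inner ℂ (V i) (V j) = 0) (hs : Summable fun i => ‖V i‖ ^ 2) :
    ∃ v, HasSum V v ∧ ‖v‖ ^ 2 ≤ ∑' i, ‖V i‖ ^ 2 := by
  have hO : OrthogonalFamily ℂ (fun i => Submodule.span ℂ {V i})
      fun i => (Submodule.span ℂ {V i}).subtypeₗᵢ := by
    refine OrthogonalFamily.of_pairwise fun i j hij => ?_
    simp only [Function.onFun, Submodule.isOrtho_span, Set.mem_singleton_iff, forall_eq]
    exact hV hij
  let w : ∀ i, Submodule.span ℂ {V i} := fun i => ⟨V i, Submodule.mem_span_singleton_self _⟩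
  have hsum : Summable V := (hO.summable_iff_norm_sq_summable w).mpr hs
  refine ⟨_, hsum.hasSum, le_of_tendsto (hsum.hasSum.norm.pow 2)
    (Filter.Eventually.of_forall fun s => ?_)⟩
  have := hO.norm_sum w s
  exact this.trans_le (hs.sum_le_tsum s fun i _ => by positivity)

/-- The union of `2M + 1` neighbouring copies of `Ω_R`. -/
def box (M : ℕ) (R : ℝ) : Set (ℝ × ℝ) :=
  Set.Ioo (-((2 * M + 1) * Real.pi)) ((2 * M + 1) * Real.pi) ×ˢ Set.Ioo (-R) R

lemma box_zero (R : ℝ) : box 0 R = cell R := by simp [box, cell]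

lemma isOpen_box (M : ℕ) (R : ℝ) : IsOpen (box M R) := isOpen_Ioo.prod isOpen_Ioo

lemma volume_box_lt_top (M : ℕ) (R : ℝ) : volume (box M R) < ⊤ :=
  ((Metric.isBounded_Ioo _ _).prod (Metric.isBounded_Ioo _ _)).measure_lt_top

/-- The quasi-periodic mode `exp(i α_j x₁) g(x₂)`. -/
noncomputable def mode (α : ℝ) (j : ℤ) (g : ℝ → ℂ) (x : ℝ × ℝ) : ℂ :=
  Complex.exp (Complex.I * (alphaj α j : ℂ) * (x.1 : ℂ)) * g x.2

lemma measurable_mode (α : ℝ) (j : ℤ) {g : ℝ → ℂ} (hg : Measurable g) :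
    Measurable (mode α j g) := by
  unfold mode; fun_prop

lemma enorm_mode (α : ℝ) (j : ℤ) (g : ℝ → ℂ) (x : ℝ × ℝ) : ‖mode α j g x‖ₑ = ‖g x.2‖ₑ := by
  rw [mode, enorm_mul, ← ofReal_norm, norm_exp_I_mul_ofReal_mul_ofReal, ENNReal.ofReal_one, one_mul]

lemma volume_restrict_box (M : ℕ) (R : ℝ) : (volume : Measure (ℝ × ℝ)).restrict (box M R)
    = (volume.restrict (Set.Ioo (-((2 * M + 1) * Real.pi)) ((2 * M + 1) * Real.pi))).prod
      (volume.restrict (Set.Ioo (-R) R)) := by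
  rw [box, Measure.prod_restrict]; rfl

lemma lintegral_box_mode_sq (α : ℝ) (j : ℤ) {g : ℝ → ℂ} (hg : Measurable g) (M : ℕ) (R : ℝ) :
    ∫⁻ x in box M R, ‖mode α j g x‖ₑ ^ 2
      = ENNReal.ofReal (2 * ((2 * M + 1) * Real.pi)) * ∫⁻ t in Set.Ioo (-R) R, ‖g t‖ₑ ^ 2 := by
  simp_rw [enorm_mode]
  rw [volume_restrict_box, lintegral_prod _ (by fun_prop)]
  simp only [lintegral_const, Measure.restrict_apply MeasurableSet.univ, Set.univ_inter,
    Real.volume_Ioo]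
  rw [mul_comm]; congr 2; ring

/-- The interval spans `2M + 1` full periods, so the primitive takes equal values at both ends. -/
lemma integral_exp_int_mul_eq_zero {n : ℤ} (hn : n ≠ 0) (M : ℕ) :
    ∫ t in Set.Ioo (-((2 * M + 1) * Real.pi)) ((2 * M + 1) * Real.pi),
      Complex.exp (Complex.I * (n : ℂ) * (t : ℂ)) = 0 := by
  have hπ := Real.pi_pos
  have hc : Complex.I * (n : ℂ) ≠ 0 := mul_ne_zero Complex.I_ne_zero (by exact_mod_cast hn)
  rw [← integral_Ioc_eq_integral_Ioo, ← intervalIntegral.integral_of_le (by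
    have : 0 < (2 * (M : ℝ) + 1) * Real.pi := by positivity
    linarith), integral_exp_mul_complex hc]
  have : Complex.exp (Complex.I * n * (((2 * M + 1) * Real.pi : ℝ) : ℂ))
      = Complex.exp (Complex.I * n * ((-((2 * M + 1) * Real.pi) : ℝ) : ℂ)) := by
    rw [Complex.exp_eq_exp_iff_exists_int]
    exact ⟨n * (2 * M + 1), by push_cast; ring⟩
  rw [this, sub_self, zero_div]

/-- Conjugation cancels `α` and leaves the nonzero integer frequency `j - i`; the product integral
factorises without any integrability of the profiles. -/
lemma integral_box_conj_mode_mul_mode {α : ℝ} {i j : ℤ} (hij : i ≠ j) (g h : ℝ → ℂ) (M : ℕ)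
    (R : ℝ) : ∫ x in box M R, mode α j h x * (starRingEnd ℂ) (mode α i g x) = 0 := by
  have e (x : ℝ × ℝ) : mode α j h x * (starRingEnd ℂ) (mode α i g x)
      = Complex.exp (Complex.I * ((j - i : ℤ) : ℂ) * (x.1 : ℂ))
        * (h x.2 * (starRingEnd ℂ) (g x.2)) := by
    simp only [mode, map_mul, ← Complex.exp_conj, Complex.conj_I, Complex.conj_ofReal]
    rw [mul_mul_mul_comm, ← Complex.exp_add]
    congr 2
    unfold alphaj
    push_cast
    ring
  simp_rw [e]
  rw [volume_restrict_box, integral_prod_mul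
    (fun t : ℝ => Complex.exp (Complex.I * ((j - i : ℤ) : ℂ) * (t : ℂ)))
    (fun t => h t * (starRingEnd ℂ) (g t)),
    integral_exp_int_mul_eq_zero (sub_ne_zero.mpr hij.symm), zero_mul]

/-- Series of modes with square summable profiles converge in `L²` of a box. -/
lemma exists_memLp_hasSum_integral_mode (α : ℝ) {g : ℤ → ℝ → ℂ} (hg : ∀ j, Measurable (g j))
    (M : ℕ) (R : ℝ) {B : ℝ≥0} (hB : ∑' j, ∫⁻ t in Set.Ioo (-R) R, ‖g j t‖ₑ ^ 2 ≤ B) :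
    ∃ v : ℝ × ℝ → ℂ, MemLp v 2 (volume.restrict (box M R)) ∧
      eLpNorm v 2 (volume.restrict (box M R)) ^ 2
        ≤ ENNReal.ofReal (2 * ((2 * M + 1) * Real.pi)) * B ∧
      ∀ χ : ℝ × ℝ → ℂ, MemLp χ 2 (volume.restrict (box M R)) →
        HasSum (fun j => ∫ x in box M R, mode α j (g j) x * χ x) (∫ x in box M R, v x * χ x) := by
  set L : ℝ≥0∞ := ENNReal.ofReal (2 * ((2 * M + 1) * Real.pi)) with hL
  have hfin : L * B < ⊤ := ENNReal.mul_lt_top ENNReal.ofReal_lt_top ENNReal.coe_lt_top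
  have htot : ∑' j, ∫⁻ x in box M R, ‖mode α j (g j) x‖ₑ ^ 2 ≤ L * B := by
    simp_rw [lintegral_box_mode_sq α _ (hg _), ENNReal.tsum_mul_left]
    gcongr
  have hmem (j : ℤ) : MemLp (mode α j (g j)) 2 (volume.restrict (box M R)) :=
    memLp_two_of_lintegral_sq_lt_top (measurable_mode α j (hg j)).aestronglyMeasurable
      (((ENNReal.le_tsum j).trans htot).trans_lt hfin)
  let V : ℤ → Lp ℂ 2 ((volume : Measure (ℝ × ℝ)).restrict (box M R)) := fun j => (hmem j).toLp
  have hVe (j : ℤ) : ‖V j‖ₑ ^ 2 = ∫⁻ x in box M R, ‖mode α j (g j) x‖ₑ ^ 2 := by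
    rw [Lp.enorm_toLp, eLpNorm_two_sq]
  -- The bilinear pairing with `χ` is the inner product with its conjugate, so continuity of the
  -- latter yields termwise integration.
  have hinner (χ : ℝ × ℝ → ℂ) (hχ : MemLp χ 2 (volume.restrict (box M R)))
      (v : Lp ℂ 2 ((volume : Measure (ℝ × ℝ)).restrict (box M R))) :
      inner ℂ hχ.star.toLp v = ∫ x in box M R, v x * χ x := by
    rw [L2.inner_def]
    refine integral_congr_ae ?_
    filter_upwards [hχ.star.coeFn_toLp] with x hx
    simp [hx, RCLike.inner_apply]
  have horth : Pairwise fun i j => inner ℂ (V i) (V j) = 0 := by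
    intro i j hij
    rw [L2.inner_def, ← integral_box_conj_mode_mul_mode (α := α) hij (g i) (g j) M R]
    refine integral_congr_ae ?_
    filter_upwards [(hmem i).coeFn_toLp, (hmem j).coeFn_toLp] with x hi hj
    simp [V, hi, hj, RCLike.inner_apply]
  have hsumE : ∑' j, ‖V j‖ₑ ^ 2 ≤ L * B := by simp_rw [hVe]; exact htot
  have hVr (j : ℤ) : ‖V j‖ₑ ^ 2 = ENNReal.ofReal (‖V j‖ ^ 2) := by
    rw [ENNReal.ofReal_pow (norm_nonneg _), ofReal_norm]
  have hsum : Summable fun j => ‖V j‖ ^ 2 := by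
    have := ENNReal.summable_toReal (f := fun j => ‖V j‖ₑ ^ 2) (hsumE.trans_lt hfin).ne
    refine this.congr fun j => ?_
    rw [hVr, ENNReal.toReal_ofReal (by positivity)]
  obtain ⟨v, hv, hvn⟩ := exists_hasSum_of_pairwise_orthogonal horth hsum
  refine ⟨v, Lp.memLp v, ?_, fun χ hχ => ?_⟩
  · rw [← Lp.enorm_def]
    refine le_trans ?_ hsumE
    rw [← ofReal_norm, ← ENNReal.ofReal_pow (norm_nonneg _)]
    simp_rw [hVr]
    rw [← ENNReal.ofReal_tsum_of_nonneg (fun j => by positivity) hsum]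
    exact ENNReal.ofReal_le_ofReal hvn
  · rw [← hinner χ hχ v]
    refine (hv.mapL (innerSL ℂ hχ.star.toLp)).congr_fun fun j => ?_
    rw [innerSL_apply_apply, hinner χ hχ]
    refine integral_congr_ae ?_
    filter_upwards [(hmem j).coeFn_toLp] with x hx
    simp only [V, hx]

/-! ### The Fourier series of the potential -/

lemma integrable_tsum_and_hasSum_integral {ι X : Type*} [Countable ι] [MeasurableSpace X]
    {μ : Measure X} {f : ι → X → ℂ} (hf : ∀ i, AEStronglyMeasurable (f i) μ)
    (h : ∑' i, ∫⁻ x, ‖f i x‖ₑ ∂μ < ⊤) :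
    Integrable (fun x => ∑' i, f i x) μ ∧
      HasSum (fun i => ∫ x, f i x ∂μ) (∫ x, ∑' i, f i x ∂μ) := by
  have hfm (i : ι) : AEMeasurable (fun x => ‖f i x‖ₑ) μ := (hf i).enorm
  have hi (i : ι) : Integrable (f i) μ := ⟨hf i, (ENNReal.le_tsum i).trans_lt h⟩
  have hsum : ∀ᵐ x ∂μ, Summable fun i => f i x := by
    rw [← lintegral_tsum hfm] at h
    filter_upwards [ae_lt_top' (AEMeasurable.tsum hfm) h.ne] with x hx
    have := ENNReal.summable_toReal hx.ne
    exact Summable.of_norm (by simpa using this)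
  refine ⟨⟨aestronglyMeasurable_of_tendsto_ae (Filter.atTop : Filter (Finset ι))
    (f := fun s x => ∑ i ∈ s, f i x)
    (fun s => Finset.aestronglyMeasurable_fun_sum s fun i _ => hf i) ?_, ?_⟩, ?_⟩
  · filter_upwards [hsum] with x hx using hx.hasSum
  · refine lt_of_le_of_lt (lintegral_mono fun x => ?_) ((lintegral_tsum hfm).trans_lt h)
    exact enorm_tsum_le_tsum_enorm
  · refine hasSum_integral_of_summable_integral_norm hi ?_
    refine (ENNReal.summable_toReal h.ne).congr fun i => ?_
    rw [integral_norm_eq_lintegral_enorm (hf i)]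

/-- Off `x₂ = 0` the terms decay exponentially, so the symmetric sum is an unconditional one; the
crude bound `e^{-s} ≤ 1/s` already gives a summable majorant. -/
lemma green_eq_tsum_mode {k : ℂ} (hk_re : 0 ≤ k.re) (hk_im : 0 ≤ k.im) {α : ℝ}
    (hkα : ∀ j : ℤ, k ^ 2 ≠ (alphaj α j : ℂ) ^ 2) {x : ℝ × ℝ} (hx : x.2 ≠ 0) :
    green k α x = ∑' j : ℤ, mode α j (modeKernel k α j) x := by
  obtain ⟨c, hc, hcj⟩ := exists_weight_le_norm_betaj hk_re hk_im hkα
  have hs : Summable fun j : ℤ => (1 / betaj k α j) *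
      Complex.exp (Complex.I * (alphaj α j : ℂ) * (x.1 : ℂ)
        + Complex.I * betaj k α j * ((|x.2| : ℝ) : ℂ)) := by
    have hx' := abs_pos.mpr hx
    refine ((summable_weight_rpow α).mul_left
      (Real.exp ((1 + ‖k‖) * |x.2|) / (c * |x.2|))).of_norm_bounded fun j => ?_
    have hw := weight_pos α j
    have h1 := one_le_weight α j
    have he := norm_exp_betaj_le hk_re hk_im α j (le_refl |x.2|)
    rw [Complex.exp_add, norm_mul, norm_mul, norm_exp_I_mul_ofReal_mul_ofReal, one_mul, norm_div,
      norm_one]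
    have hdecay : Real.exp (-(weight α j * |x.2|)) ≤ 1 / (weight α j * |x.2|) := by
      rw [Real.exp_neg, ← one_div]
      have := Real.add_one_le_exp (weight α j * |x.2|)
      gcongr
      linarith
    have hpow : 1 / (weight α j * weight α j) ≤ weight α j ^ (-(3 / 2) : ℝ) := by
      rw [← pow_two, one_div, ← Real.rpow_natCast, ← Real.rpow_neg hw.le]
      exact Real.rpow_le_rpow_of_exponent_le h1 (by norm_num)
    calc _ ≤ 1 / (c * weight α j) *
          (Real.exp ((1 + ‖k‖) * |x.2|) * (1 / (weight α j * |x.2|))) := by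
          gcongr
          · exact hcj j
          · refine he.trans ?_
            gcongr
      _ = Real.exp ((1 + ‖k‖) * |x.2|) / (c * |x.2|) * (1 / (weight α j * weight α j)) := by
          field_simp
      _ ≤ _ := by gcongr
  rw [green, tsum_eq_of_summable_unconditional hs, ← tsum_mul_left]
  refine tsum_congr fun j => ?_
  rw [mode, modeKernel_eq, Complex.exp_add]
  ring

/-- The `L²` norm in `y` of the kernel's majorant is of order `w^{-3/2}`. Cauchy–Schwarz enters in
additive form, so `C` depends on `F` inhomogeneously; this is harmless, since the bound only serves
convergence. -/
lemma exists_lintegral_mode_sub_mul_le {k : ℂ} (hk_re : 0 ≤ k.re) (hk_im : 0 ≤ k.im) {α : ℝ}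
    (hkα : ∀ j : ℤ, k ^ 2 ≠ (alphaj α j : ℂ) ^ 2) {ρ : ℝ} {F : ℝ × ℝ → ℂ} (hF : IsDensity ρ F)
    (R : ℝ) : ∃ C : ℝ≥0, ∀ (j : ℤ) (x : ℝ × ℝ), |x.2| ≤ R →
      ∫⁻ y, ‖mode α j (modeKernel k α j) (x - y) * F y‖ₑ
        ≤ C * ENNReal.ofReal (weight α j ^ (-(3 / 2) : ℝ)) := by
  obtain ⟨c, hc, hcj⟩ := exists_weight_le_norm_betaj hk_re hk_im hkα
  have hπ := Real.pi_pos
  have hFm := hF.measurable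
  set p : ℝ := Real.exp ((1 + ‖k‖) * (R + ρ)) / c with hp
  have hp0 : 0 < p := by positivity
  refine ⟨Real.toNNReal (2 * Real.pi * p ^ 2) + (∫⁻ y, ‖F y‖ₑ ^ 2).toNNReal, fun j x hx => ?_⟩
  have hw := weight_pos α j
  set a := weight α j with ha
  set b : ℝ := a ^ (-(3 / 2) : ℝ) with hb
  have hb0 : 0 < b := by positivity
  have hb2 : b ^ 2 * a ^ 3 = 1 := by
    rw [hb, ← Real.rpow_natCast, ← Real.rpow_natCast, ← Real.rpow_mul hw.le, ← Real.rpow_add hw]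
    norm_num
  -- The weights are balanced: integrating `exp(-2a|t|)` gains `1/a`, after which both terms are of
  -- order `b = a^{-3/2}`.
  have young (u v : ℝ) : u * v / a ≤ b * a * u ^ 2 + b * v ^ 2 := by
    have hs := Real.sq_sqrt hw.le
    have hbs : b * a * √a = 1 := by
      rw [← pow_eq_one_iff_of_nonneg (by positivity) two_ne_zero]
      linear_combination hb2 + b ^ 2 * a ^ 2 * hs
    have h1 : u * v / a = b * (√a * u * v) := by
      rw [div_eq_iff hw.ne']
      linear_combination (-(u * v)) * hbs
    have h2 : √a * u * v ≤ a * u ^ 2 + v ^ 2 := by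
      nlinarith [sq_nonneg (√a * u - v), sq_nonneg (√a * u), sq_nonneg v]
    rw [h1, mul_assoc b a, ← mul_add]
    gcongr
  have bound (y : ℝ × ℝ) (hy : y ∈ cell ρ) :
      ‖mode α j (modeKernel k α j) (x - y) * F y‖ₑ
        ≤ ENNReal.ofReal (b * a * p ^ 2) * ENNReal.ofReal (Real.exp (-(2 * a * |x.2 - y.2|)))
          + ENNReal.ofReal b * ‖F y‖ₑ ^ 2 := by
    have ht : |x.2 - y.2| ≤ R + ρ := by
      have := abs_sub x.2 y.2
      have := abs_lt.mpr hy.2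
      linarith
    rw [enorm_mul, enorm_mode, ← enorm_mul, ← ofReal_norm, ← ofReal_norm,
      ← ENNReal.ofReal_mul (by positivity), ← ENNReal.ofReal_pow (norm_nonneg _),
      ← ENNReal.ofReal_mul hb0.le, ← ENNReal.ofReal_add (by positivity) (by positivity)]
    refine ENNReal.ofReal_le_ofReal ?_
    have h1 := norm_modeKernel_le hk_re hk_im hc (hcj j) ht
    have h2 : Real.exp (-(2 * a * |x.2 - y.2|)) = Real.exp (-(a * |x.2 - y.2|)) ^ 2 := by
      rw [← Real.exp_nat_mul]; congr 1; push_cast; ring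
    rw [norm_mul, h2]
    calc ‖modeKernel k α j (x.2 - y.2)‖ * ‖F y‖
        ≤ Real.exp ((1 + ‖k‖) * (R + ρ)) / (c * a) * Real.exp (-(a * |x.2 - y.2|)) * ‖F y‖ := by
          gcongr
      _ = (p * Real.exp (-(a * |x.2 - y.2|))) * ‖F y‖ / a := by
          rw [hp]; field_simp
      _ ≤ _ := young _ _
      _ = _ := by ring
  have hint : ∫⁻ y in cell ρ, ENNReal.ofReal (Real.exp (-(2 * a * |x.2 - y.2|)))
      ≤ ENNReal.ofReal (2 * Real.pi) * ENNReal.ofReal (2 / (2 * a)) := by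
    rw [← box_zero, volume_restrict_box, lintegral_prod _ (by fun_prop)]
    simp only [lintegral_const, Measure.restrict_apply MeasurableSet.univ, Set.univ_inter,
      Real.volume_Ioo]
    rw [mul_comm]
    gcongr
    · apply le_of_eq; push_cast; ring
    · refine (setLIntegral_le_lintegral _ _).trans_eq ?_
      rw [lintegral_sub_left_eq_self (fun t => ENNReal.ofReal (Real.exp (-(2 * a * |t|)))),
        lintegral_exp_neg_mul_abs (by positivity)]
  calc ∫⁻ y, ‖mode α j (modeKernel k α j) (x - y) * F y‖ₑ
      = ∫⁻ y in cell ρ, ‖mode α j (modeKernel k α j) (x - y) * F y‖ₑ := by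
        rw [setLIntegral_eq_of_support_subset]
        intro y hy
        by_contra hn
        simp [hF.eq_zero y hn] at hy
    _ ≤ ∫⁻ y in cell ρ, (ENNReal.ofReal (b * a * p ^ 2)
          * ENNReal.ofReal (Real.exp (-(2 * a * |x.2 - y.2|))) + ENNReal.ofReal b * ‖F y‖ₑ ^ 2) :=
        setLIntegral_mono (by fun_prop) bound
    _ ≤ ENNReal.ofReal (b * a * p ^ 2) * (ENNReal.ofReal (2 * Real.pi) * ENNReal.ofReal (2 / (2 * a)))
          + ENNReal.ofReal b * ∫⁻ y, ‖F y‖ₑ ^ 2 := by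
        rw [lintegral_add_left (by fun_prop), lintegral_const_mul _ (by fun_prop),
          lintegral_const_mul _ (by fun_prop)]
        gcongr
        exact Measure.restrict_le_self
    _ = _ := by
        rw [← ENNReal.ofReal_mul (by positivity), ← ENNReal.ofReal_mul (by positivity),
          ENNReal.coe_add, ENNReal.coe_toNNReal hF.lintegral_sq_lt_top.ne, add_mul,
          mul_comm (ENNReal.ofReal b)]
        congr 1
        change _ = ENNReal.ofReal _ * _
        rw [← ENNReal.ofReal_mul (by positivity)]
        congr 1
        field_simp

/-- The volume potential of a density on the plane. -/
noncomputable def potential (k : ℂ) (α : ℝ) (F : ℝ × ℝ → ℂ) (x : ℝ × ℝ) : ℂ :=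
  ∫ y, green k α (x - y) * F y

lemma tsum_ofReal_weight_lt_top (α : ℝ) :
    ∑' j : ℤ, ENNReal.ofReal (weight α j ^ (-(3 / 2) : ℝ)) < ⊤ := by
  rw [← ENNReal.ofReal_tsum_of_nonneg (fun j => Real.rpow_nonneg (weight_pos α j).le _)
    (summable_weight_rpow α)]
  exact ENNReal.ofReal_lt_top

lemma ae_snd_ne (t : ℝ) : ∀ᵐ y : ℝ × ℝ, y.2 ≠ t := by
  have : (volume : Measure (ℝ × ℝ)) (Set.univ ×ˢ {t}) = 0 := by
    rw [Measure.volume_eq_prod, Measure.prod_prod]; simp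
  rw [ae_iff]
  convert this using 2
  ext y; simp

lemma IsDensity.measurable_mode_sub_mul {ρ : ℝ} {F : ℝ × ℝ → ℂ} (hF : IsDensity ρ F) (k : ℂ) (α : ℝ)
    (j : ℤ) (x : ℝ × ℝ) : Measurable fun y => mode α j (modeKernel k α j) (x - y) * F y := by
  have := hF.measurable
  have := measurable_mode α j (measurable_modeKernel k α j)
  fun_prop

lemma IsDensity.integrable_mode_sub_mul {k : ℂ} (hk_re : 0 ≤ k.re) (hk_im : 0 ≤ k.im) {α : ℝ}
    (hkα : ∀ j : ℤ, k ^ 2 ≠ (alphaj α j : ℂ) ^ 2) {ρ : ℝ} {F : ℝ × ℝ → ℂ} (hF : IsDensity ρ F)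
    (j : ℤ) (x : ℝ × ℝ) : Integrable fun y => mode α j (modeKernel k α j) (x - y) * F y := by
  obtain ⟨C, hC⟩ := exists_lintegral_mode_sub_mul_le hk_re hk_im hkα hF |x.2|
  exact ⟨(hF.measurable_mode_sub_mul k α j x).aestronglyMeasurable,
    (hC j x le_rfl).trans_lt (ENNReal.mul_lt_top ENNReal.coe_lt_top ENNReal.ofReal_lt_top)⟩

lemma integral_mode_sub_mul {k : ℂ} (hk_re : 0 ≤ k.re) (hk_im : 0 ≤ k.im) {α : ℝ}
    (hkα : ∀ j : ℤ, k ^ 2 ≠ (alphaj α j : ℂ) ^ 2) {ρ : ℝ} {F : ℝ × ℝ → ℂ} (hF : IsDensity ρ F)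
    (j : ℤ) (x : ℝ × ℝ) :
    ∫ y, mode α j (modeKernel k α j) (x - y) * F y = mode α j (profile k α F j 0) x := by
  have hi := hF.integrable_mode_sub_mul hk_re hk_im hkα j x
  rw [Measure.volume_eq_prod] at hi ⊢
  rw [integral_prod_symm _ hi, mode, profile, ← integral_const_mul]
  refine integral_congr_ae (Filter.Eventually.of_forall fun y₂ => ?_)
  simp only [coeff]
  rw [← integral_const_mul, ← integral_const_mul]
  refine integral_congr_ae (Filter.Eventually.of_forall fun y₁ => ?_)
  simp only [mode, Prod.fst_sub, Prod.snd_sub]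
  have : Complex.exp (Complex.I * (alphaj α j : ℂ) * ((x.1 - y₁ : ℝ) : ℂ))
      = Complex.exp (Complex.I * (alphaj α j : ℂ) * (x.1 : ℂ))
        * Complex.exp (-(Complex.I * (alphaj α j : ℂ) * (y₁ : ℂ))) := by
    rw [← Complex.exp_add]; congr 1; push_cast; ring
  rw [this]
  ring

/-- The potential converges absolutely and is the sum of its Fourier modes. -/
lemma integrable_green_mul_and_hasSum {k : ℂ} (hk_re : 0 ≤ k.re) (hk_im : 0 ≤ k.im) {α : ℝ}
    (hkα : ∀ j : ℤ, k ^ 2 ≠ (alphaj α j : ℂ) ^ 2) {ρ : ℝ} {F : ℝ × ℝ → ℂ} (hF : IsDensity ρ F)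
    (x : ℝ × ℝ) : Integrable (fun y => green k α (x - y) * F y) ∧
      HasSum (fun j => mode α j (profile k α F j 0) x) (potential k α F x) := by
  obtain ⟨C, hC⟩ := exists_lintegral_mode_sub_mul_le hk_re hk_im hkα hF |x.2|
  have hfin : ∑' j, ∫⁻ y, ‖mode α j (modeKernel k α j) (x - y) * F y‖ₑ < ⊤ := by
    refine (ENNReal.tsum_le_tsum fun j => hC j x le_rfl).trans_lt ?_
    rw [ENNReal.tsum_mul_left]
    exact ENNReal.mul_lt_top ENNReal.coe_lt_top (tsum_ofReal_weight_lt_top α)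
  obtain ⟨h1, h2⟩ := integrable_tsum_and_hasSum_integral
    (fun j => (hF.measurable_mode_sub_mul k α j x).aestronglyMeasurable) hfin
  have hae : (fun y => ∑' j, mode α j (modeKernel k α j) (x - y) * F y)
      =ᵐ[volume] fun y => green k α (x - y) * F y := by
    -- The line `y₂ = x₂`, where the series need not converge absolutely, is a null set.
    filter_upwards [ae_snd_ne x.2] with y hy
    rw [tsum_mul_right, green_eq_tsum_mode hk_re hk_im hkα (sub_ne_zero.mpr hy.symm)]
  refine ⟨h1.congr hae, ?_⟩
  rw [potential, ← integral_congr_ae hae]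
  simpa only [integral_mode_sub_mul hk_re hk_im hkα hF] using h2

/-- The series of modes of the potential may be integrated termwise against bounded functions. -/
lemma integrable_potential_and_hasSum {k : ℂ} (hk_re : 0 ≤ k.re) (hk_im : 0 ≤ k.im) {α : ℝ}
    (hkα : ∀ j : ℤ, k ^ 2 ≠ (alphaj α j : ℂ) ^ 2) {ρ : ℝ} {F : ℝ × ℝ → ℂ} (hF : IsDensity ρ F)
    (M : ℕ) (R : ℝ) {χ : ℝ × ℝ → ℂ} (hχ : Measurable χ) {K : ℝ} (hK : ∀ x, ‖χ x‖ ≤ K) :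
    IntegrableOn (fun x => potential k α F x * χ x) (box M R) ∧
      HasSum (fun j => ∫ x in box M R, mode α j (profile k α F j 0) x * χ x)
        (∫ x in box M R, potential k α F x * χ x) := by
  obtain ⟨C, hC⟩ := exists_lintegral_mode_sub_mul_le hk_re hk_im hkα hF R
  have hm (j : ℤ) := measurable_mode α j (hF.measurable_profile k α j 0)
  have hb (j : ℤ) : ∫⁻ x in box M R, ‖mode α j (profile k α F j 0) x * χ x‖ₑ
      ≤ C * ENNReal.ofReal (weight α j ^ (-(3 / 2) : ℝ)) * (ENNReal.ofReal K * volume (box M R)) := by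
    rw [← mul_assoc, ← setLIntegral_const]
    refine setLIntegral_mono measurable_const fun x hx => ?_
    rw [enorm_mul, ← integral_mode_sub_mul hk_re hk_im hkα hF]
    gcongr
    · exact (enorm_integral_le_lintegral_enorm _).trans (hC j x (abs_lt.mpr hx.2).le)
    · exact enorm_le_ofReal (hK x)
  have hfin : ∑' j, ∫⁻ x in box M R, ‖mode α j (profile k α F j 0) x * χ x‖ₑ < ⊤ := by
    refine (ENNReal.tsum_le_tsum hb).trans_lt ?_
    rw [ENNReal.tsum_mul_right, ENNReal.tsum_mul_left]
    exact ENNReal.mul_lt_top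
      (ENNReal.mul_lt_top ENNReal.coe_lt_top (tsum_ofReal_weight_lt_top α))
      (ENNReal.mul_lt_top ENNReal.ofReal_lt_top (volume_box_lt_top M R))
  have h := integrable_tsum_and_hasSum_integral
    (fun j => ((hm j).mul hχ).aestronglyMeasurable) hfin
  have e : (fun x => potential k α F x * χ x)
      = fun x => ∑' j, mode α j (profile k α F j 0) x * χ x := by
    funext x
    rw [tsum_mul_right, (integrable_green_mul_and_hasSum hk_re hk_im hkα hF x).2.tsum_eq]
  rw [e]
  exact h

/-! ### Weak derivatives of the modes -/

/-- `h'` is the weak derivative of `h` on the line. -/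
def HasWeakDerivLine (h h' : ℝ → ℂ) : Prop :=
  ∀ ψ : ℝ → ℂ, ContDiff ℝ 1 ψ → HasCompactSupport ψ →
    ∫ x, h x * deriv ψ x = -∫ x, h' x * ψ x

/-- Fubini; it moves a derivative falling on the test function over to the explicit kernel. -/
lemma integrable_and_integral_conv_mul {κ h χ : ℝ → ℂ} (hκ : Measurable κ) {K : ℝ}
    (hK : ∀ t, ‖κ t‖ ≤ K) (hh : Integrable h) (hχ : Integrable χ) :
    Integrable (fun x => (∫ y, κ (x - y) * h y) * χ x) ∧
      ∫ x, (∫ y, κ (x - y) * h y) * χ x = ∫ y, h y * ∫ x, κ (x - y) * χ x := by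
  have hi : Integrable (fun p : ℝ × ℝ => κ (p.1 - p.2) * (χ p.1 * h p.2))
      ((volume : Measure ℝ).prod volume) :=
    (hχ.mul_prod hh).bdd_mul (c := K)
      (hκ.comp (measurable_fst.sub measurable_snd)).aestronglyMeasurable
      (Filter.Eventually.of_forall fun p => hK _)
  have e (x : ℝ) : (∫ y, κ (x - y) * h y) * χ x = ∫ y, κ (x - y) * (χ x * h y) := by
    rw [← integral_mul_const]
    exact integral_congr_ae (Filter.Eventually.of_forall fun y => by ring)
  simp_rw [e]
  refine ⟨hi.integral_prod_left, ?_⟩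
  rw [integral_integral_swap hi]
  refine integral_congr_ae (Filter.Eventually.of_forall fun y => ?_)
  simp only
  rw [← integral_const_mul]
  exact integral_congr_ae (Filter.Eventually.of_forall fun x => by ring)

/-- Fubini runs over the whole line, so here only `Im β_j ≥ 0` is used, giving a bound for all `t`.
-/
lemma norm_modeKernel_le_const {k : ℂ} (hk_re : 0 ≤ k.re) (hk_im : 0 ≤ k.im) (α : ℝ) (j : ℤ)
    (t : ℝ) : ‖modeKernel k α j t‖ ≤ 1 / (4 * Real.pi) / ‖betaj k α j‖ := by
  have := Real.pi_pos
  rw [norm_modeKernel]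
  exact mul_le_of_le_one_right (by positivity) (norm_exp_betaj_le_one hk_re hk_im α j t)

lemma norm_modeKernelDeriv_le_const {k : ℂ} (hk_re : 0 ≤ k.re) (hk_im : 0 ≤ k.im) (α : ℝ) (j : ℤ)
    (t : ℝ) : ‖modeKernelDeriv k α j t‖ ≤ 1 / (4 * Real.pi) := by
  have := Real.pi_pos
  rw [norm_modeKernelDeriv]
  exact mul_le_of_le_one_right (by positivity) (norm_exp_betaj_le_one hk_re hk_im α j t)

lemma hasWeakDerivLine_profile_zero {k : ℂ} (hk_re : 0 ≤ k.re) (hk_im : 0 ≤ k.im) {α : ℝ}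
    (hkα : ∀ j : ℤ, k ^ 2 ≠ (alphaj α j : ℂ) ^ 2) {ρ : ℝ} {F : ℝ × ℝ → ℂ} (hF : IsDensity ρ F)
    (j : ℤ) : HasWeakDerivLine (profile k α F j 0) (profile k α F j 1) := by
  intro ψ hψ hc
  have hψi : Integrable ψ := hψ.continuous.integrable_of_hasCompactSupport hc
  have hψi' : Integrable (deriv ψ) :=
    (hψ.continuous_deriv le_rfl).integrable_of_hasCompactSupport hc.deriv
  have hcf := hF.integrable_coeff α j
  have h0 := (integrable_and_integral_conv_mul (measurable_modeKernel k α j)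
    (norm_modeKernel_le_const hk_re hk_im α j) hcf hψi').2
  have h1 := (integrable_and_integral_conv_mul (measurable_modeKernelDeriv k α j)
    (norm_modeKernelDeriv_le_const hk_re hk_im α j) hcf hψi).2
  refine h0.trans (Eq.trans ?_ (congrArg Neg.neg h1.symm))
  rw [← integral_neg]
  refine integral_congr_ae (Filter.Eventually.of_forall fun y => ?_)
  beta_reduce
  rw [integral_modeKernel_mul_deriv (betaj_ne_zero hkα j) hψ hc, mul_neg]

lemma hasWeakDerivLine_profile_one {k : ℂ} (hk_re : 0 ≤ k.re) (hk_im : 0 ≤ k.im) {α : ℝ}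
    (hkα : ∀ j : ℤ, k ^ 2 ≠ (alphaj α j : ℂ) ^ 2) {ρ : ℝ} {F : ℝ × ℝ → ℂ} (hF : IsDensity ρ F)
    (j : ℤ) : HasWeakDerivLine (profile k α F j 1) (profile k α F j 2) := by
  intro ψ hψ hc
  have hψi : Integrable ψ := hψ.continuous.integrable_of_hasCompactSupport hc
  have hψi' : Integrable (deriv ψ) :=
    (hψ.continuous_deriv le_rfl).integrable_of_hasCompactSupport hc.deriv
  have hcf := hF.integrable_coeff α j
  obtain ⟨i0, h0⟩ := integrable_and_integral_conv_mul (measurable_modeKernel k α j)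
    (norm_modeKernel_le_const hk_re hk_im α j) hcf hψi
  have h1 := (integrable_and_integral_conv_mul (measurable_modeKernelDeriv k α j)
    (norm_modeKernelDeriv_le_const hk_re hk_im α j) hcf hψi').2
  obtain ⟨B, hB⟩ := hc.exists_bound_of_continuous hψ.continuous
  have hcψ : Integrable fun y => coeff α F j y * ψ y :=
    hcf.mul_bdd (c := B) hψ.continuous.aestronglyMeasurable (Filter.Eventually.of_forall hB)
  have hE : Integrable fun y => coeff α F j y * ∫ x, modeKernel k α j (x - y) * ψ x := by
    refine hcf.mul_bdd (c := 1 / (4 * Real.pi) / ‖betaj k α j‖ * ∫ x, ‖ψ x‖) ?_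
      (Filter.Eventually.of_forall fun y => ?_)
    · have h : Measurable fun p : ℝ × ℝ => modeKernel k α j (p.2 - p.1) * ψ p.2 := by
        have := measurable_modeKernel k α j
        have := hψ.continuous.measurable
        fun_prop
      exact h.stronglyMeasurable.integral_prod_right'.aestronglyMeasurable
    · rw [← integral_const_mul]
      refine norm_integral_le_of_norm_le (hψi.norm.const_mul _)
        (Filter.Eventually.of_forall fun x => ?_)
      rw [norm_mul]
      gcongr
      exact norm_modeKernel_le_const hk_re hk_im α j _
  have lhs : ∫ y, coeff α F j y * ∫ x, modeKernelDeriv k α j (x - y) * deriv ψ x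
      = 1 / (2 * (Real.pi : ℂ)) * (∫ y, coeff α F j y * ψ y)
        + betaj k α j ^ 2 * ∫ y, coeff α F j y * ∫ x, modeKernel k α j (x - y) * ψ x := by
    rw [← integral_const_mul, ← integral_const_mul,
      ← integral_add (hcψ.const_mul _) (hE.const_mul _)]
    refine integral_congr_ae (Filter.Eventually.of_forall fun y => ?_)
    beta_reduce
    rw [integral_modeKernelDeriv_mul_deriv (betaj_ne_zero hkα j) hψ hc]
    ring
  refine h1.trans (lhs.trans ?_)
  rw [← h0, ← integral_const_mul, ← integral_const_mul,
    ← integral_add (hcψ.const_mul _) (i0.const_mul _), ← integral_neg]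
  refine integral_congr_ae (Filter.Eventually.of_forall fun y => ?_)
  simp only [profile]
  ring

/-! ### Test functions in the plane and their slices. -/

section slices

variable {ψ : ℝ × ℝ → ℂ}

lemma hasDerivAt_slice_fst (hψ : ContDiff ℝ ∞ ψ) (t s : ℝ) :
    HasDerivAt (fun t => ψ (t, s)) (pderiv₁ ψ (t, s)) t :=
  ((hψ.differentiable (by simp)) (t, s)).hasFDerivAt.comp_hasDerivAt t
    ((hasDerivAt_id t).prodMk (hasDerivAt_const t s))

lemma hasDerivAt_slice_snd (hψ : ContDiff ℝ ∞ ψ) (t s : ℝ) :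
    HasDerivAt (fun s => ψ (t, s)) (pderiv₂ ψ (t, s)) s :=
  ((hψ.differentiable (by simp)) (t, s)).hasFDerivAt.comp_hasDerivAt s
    ((hasDerivAt_const s t).prodMk (hasDerivAt_id s))

lemma contDiff_pderiv₁ (hψ : ContDiff ℝ ∞ ψ) : ContDiff ℝ ∞ (pderiv₁ ψ) :=
  (hψ.fderiv_right (m := ∞) (by simp)).clm_apply contDiff_const

lemma contDiff_pderiv₂ (hψ : ContDiff ℝ ∞ ψ) : ContDiff ℝ ∞ (pderiv₂ ψ) :=
  (hψ.fderiv_right (m := ∞) (by simp)).clm_apply contDiff_const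

lemma tsupport_pderiv₁_subset : tsupport (pderiv₁ ψ) ⊆ tsupport ψ :=
  tsupport_fderiv_apply_subset ℝ (1, 0)

lemma tsupport_pderiv₂_subset : tsupport (pderiv₂ ψ) ⊆ tsupport ψ :=
  tsupport_fderiv_apply_subset ℝ (0, 1)

lemma hasCompactSupport_slice_fst (hc : HasCompactSupport ψ) (s : ℝ) :
    HasCompactSupport fun t => ψ (t, s) := by
  refine HasCompactSupport.intro (hc.isCompact.image continuous_fst) fun t ht => ?_
  by_contra h
  exact ht ⟨(t, s), subset_tsupport _ h, rfl⟩

lemma hasCompactSupport_slice_snd (hc : HasCompactSupport ψ) (t : ℝ) :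
    HasCompactSupport fun s => ψ (t, s) := by
  refine HasCompactSupport.intro (hc.isCompact.image continuous_snd) fun s hs => ?_
  by_contra h
  exact hs ⟨(t, s), subset_tsupport _ h, rfl⟩

end slices

/-- A smooth function with compact support in `U`. -/
structure IsTest (U : Set (ℝ × ℝ)) (φ : ℝ × ℝ → ℂ) : Prop where
  contDiff : ContDiff ℝ ∞ φ
  hasCompactSupport : HasCompactSupport φ
  tsupport_subset : tsupport φ ⊆ U

namespace IsTest

variable {U : Set (ℝ × ℝ)} {φ : ℝ × ℝ → ℂ}

lemma pderiv₁ (h : IsTest U φ) : IsTest U (pderiv₁ φ) :=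
  ⟨contDiff_pderiv₁ h.contDiff, h.hasCompactSupport.mono' (subset_tsupport _ |>.trans
    tsupport_pderiv₁_subset), tsupport_pderiv₁_subset.trans h.tsupport_subset⟩

lemma pderiv₂ (h : IsTest U φ) : IsTest U (pderiv₂ φ) :=
  ⟨contDiff_pderiv₂ h.contDiff, h.hasCompactSupport.mono' (subset_tsupport _ |>.trans
    tsupport_pderiv₂_subset), tsupport_pderiv₂_subset.trans h.tsupport_subset⟩

lemma pderiv₁_iterate (h : IsTest U φ) (n : ℕ) : IsTest U (QPVolumePotential.pderiv₁^[n] φ) := by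
  induction n with
  | zero => exact h
  | succ n ih => rw [Function.iterate_succ_apply']; exact ih.pderiv₁

lemma pderiv₂_iterate (h : IsTest U φ) (n : ℕ) : IsTest U (QPVolumePotential.pderiv₂^[n] φ) := by
  induction n with
  | zero => exact h
  | succ n ih => rw [Function.iterate_succ_apply']; exact ih.pderiv₂

lemma exists_bound (h : IsTest U φ) : ∃ K, ∀ x, ‖φ x‖ ≤ K :=
  h.hasCompactSupport.exists_bound_of_continuous h.contDiff.continuous

lemma eq_zero (h : IsTest U φ) {x : ℝ × ℝ} (hx : x ∉ U) : φ x = 0 :=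
  image_eq_zero_of_notMem_tsupport fun hx' => hx (h.tsupport_subset hx')

lemma setIntegral_mul_eq (h : IsTest U φ) (u : ℝ × ℝ → ℂ) :
    ∫ x in U, u x * φ x = ∫ x, u x * φ x :=
  setIntegral_eq_integral_of_forall_compl_eq_zero fun x hx => by rw [h.eq_zero hx, mul_zero]

lemma integrable_mul (h : IsTest U φ) {u : ℝ × ℝ → ℂ} (hu : IntegrableOn u U) :
    Integrable fun x => u x * φ x := by
  obtain ⟨K, hK⟩ := h.exists_bound
  have : IntegrableOn (fun x => u x * φ x) U :=
    hu.mul_bdd (c := K) h.contDiff.continuous.aestronglyMeasurable (Filter.Eventually.of_forall hK)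
  exact this.integrable_of_forall_notMem_eq_zero fun x hx => by rw [h.eq_zero hx, mul_zero]

end IsTest

/-- Integration by parts on each horizontal line, where `h` is a constant factor; no regularity of
`h` is needed. -/
lemma integral_mode_mul_pderiv₁ {U : Set (ℝ × ℝ)} {ψ : ℝ × ℝ → ℂ} (hψ : IsTest U ψ) {α : ℝ} {j : ℤ}
    {h : ℝ → ℂ} (hh : IntegrableOn (mode α j h) U) :
    ∫ x, mode α j h x * pderiv₁ ψ x
      = -(Complex.I * (alphaj α j : ℂ)) * ∫ x, mode α j h x * ψ x := by
  have i1 := hψ.pderiv₁.integrable_mul hh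
  have i0 := hψ.integrable_mul hh
  rw [Measure.volume_eq_prod] at i0 i1 ⊢
  rw [integral_prod_symm _ i1, integral_prod_symm _ i0, ← integral_const_mul]
  refine integral_congr_ae (Filter.Eventually.of_forall fun s => ?_)
  change ∫ t, mode α j h (t, s) * pderiv₁ ψ (t, s)
    = -(Complex.I * (alphaj α j : ℂ)) * ∫ t, mode α j h (t, s) * ψ (t, s)
  set e : ℝ → ℂ := fun t => Complex.exp (Complex.I * (alphaj α j : ℂ) * (t : ℂ)) with he
  have hec : Continuous e := by fun_prop
  have hcs := hasCompactSupport_slice_fst hψ.hasCompactSupport s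
  have hcs' := hasCompactSupport_slice_fst hψ.pderiv₁.hasCompactSupport s
  have c0 : Continuous fun t => ψ (t, s) := hψ.contDiff.continuous.comp (by fun_prop)
  have c1 : Continuous fun t => pderiv₁ ψ (t, s) :=
    hψ.pderiv₁.contDiff.continuous.comp (by fun_prop)
  have der (t : ℝ) : HasDerivAt e (Complex.I * (alphaj α j : ℂ) * e t) t := by
    refine ((Complex.ofRealCLM.hasDerivAt (x := t)).const_mul
      (Complex.I * (alphaj α j : ℂ))).cexp.congr_deriv ?_
    rw [Complex.ofRealCLM_apply, Complex.ofRealCLM_apply, Complex.ofReal_one, mul_one, mul_comm]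
  have parts := integral_mul_deriv_eq_deriv_mul_of_integrable (u := e) (v := fun t => ψ (t, s))
    (fun t _ => der t) (fun t _ => hasDerivAt_slice_fst hψ.contDiff t s)
    ((hec.mul c1).integrable_of_hasCompactSupport hcs'.mul_left)
    (((hec.const_mul _).mul c0).integrable_of_hasCompactSupport hcs.mul_left)
    ((hec.mul c0).integrable_of_hasCompactSupport hcs.mul_left)
  calc ∫ t, mode α j h (t, s) * pderiv₁ ψ (t, s)
      = h s * ∫ t, e t * pderiv₁ ψ (t, s) := by
        rw [← integral_const_mul]
        exact integral_congr_ae (Filter.Eventually.of_forall fun t => by simp only [mode, he]; ring)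
    _ = _ := by
        rw [parts, ← integral_neg, ← integral_const_mul, ← integral_const_mul]
        exact integral_congr_ae (Filter.Eventually.of_forall fun t => by simp only [mode, he]; ring)

lemma integral_mode_mul_pderiv₂ {U : Set (ℝ × ℝ)} {ψ : ℝ × ℝ → ℂ} (hψ : IsTest U ψ) {α : ℝ} {j : ℤ}
    {h h' : ℝ → ℂ} (hh : IntegrableOn (mode α j h) U) (hh' : IntegrableOn (mode α j h') U)
    (hw : HasWeakDerivLine h h') :
    ∫ x, mode α j h x * pderiv₂ ψ x = -∫ x, mode α j h' x * ψ x := by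
  have i1 := hψ.pderiv₂.integrable_mul hh
  have i0 := hψ.integrable_mul hh'
  rw [Measure.volume_eq_prod] at i0 i1 ⊢
  rw [integral_prod _ i1, integral_prod _ i0, ← integral_neg]
  refine integral_congr_ae (Filter.Eventually.of_forall fun t => ?_)
  have hs := hw (fun s => ψ (t, s)) ((hψ.contDiff.comp (by fun_prop)).of_le (by simp))
    (hasCompactSupport_slice_snd hψ.hasCompactSupport t)
  simp only [(hasDerivAt_slice_snd hψ.contDiff t _).deriv] at hs
  simp only [mode, mul_assoc]
  rw [integral_const_mul, hs, integral_const_mul, mul_neg]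

/-! ### Weak derivatives of the potential -/

lemma IsTest.integral_mode_mul_pderiv₁_iterate {U : Set (ℝ × ℝ)} {α : ℝ} {j : ℤ} {h : ℝ → ℂ}
    (hh : IntegrableOn (mode α j h) U) {ψ : ℝ × ℝ → ℂ} (hψ : IsTest U ψ) (n : ℕ) :
    ∫ x, mode α j h x * (QPVolumePotential.pderiv₁^[n] ψ) x
      = (-1) ^ n * ∫ x, mode α j (fun t => (Complex.I * (alphaj α j : ℂ)) ^ n * h t) x * ψ x := by
  have key : ∫ x, mode α j h x * (QPVolumePotential.pderiv₁^[n] ψ) x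
      = (-(Complex.I * (alphaj α j : ℂ))) ^ n * ∫ x, mode α j h x * ψ x := by
    induction n with
    | zero => simp
    | succ n ih =>
      rw [Function.iterate_succ_apply', integral_mode_mul_pderiv₁ (hψ.pderiv₁_iterate n) hh, ih]
      ring
  rw [key, neg_pow, mul_assoc, ← integral_const_mul]
  congr 1
  exact integral_congr_ae (Filter.Eventually.of_forall fun x => by simp only [mode]; ring)

lemma IsTest.integral_mode_profile_mul_pderiv {k : ℂ} (hk_re : 0 ≤ k.re) (hk_im : 0 ≤ k.im) {α : ℝ}
    (hkα : ∀ j : ℤ, k ^ 2 ≠ (alphaj α j : ℂ) ^ 2) {ρ : ℝ} {F : ℝ × ℝ → ℂ} (hF : IsDensity ρ F)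
    {j : ℤ} {U : Set (ℝ × ℝ)} (hU : ∀ n ≤ 2, IntegrableOn (mode α j (profile k α F j n)) U)
    {φ : ℝ × ℝ → ℂ} (hφ : IsTest U φ) {m : ℕ × ℕ} (hm : m.1 + m.2 ≤ 2) :
    ∫ x, mode α j (profile k α F j 0) x *
        (QPVolumePotential.pderiv₁^[m.1] (QPVolumePotential.pderiv₂^[m.2] φ)) x
      = (-1) ^ (m.1 + m.2) * ∫ x, mode α j
          (fun t => (Complex.I * (alphaj α j : ℂ)) ^ m.1 * profile k α F j m.2 t) x * φ x := by
  obtain ⟨m₁, m₂⟩ := m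
  have hpull (n : ℕ) (x : ℝ × ℝ) :
      mode α j (fun t => (Complex.I * (alphaj α j : ℂ)) ^ m₁ * profile k α F j n t) x
        = (Complex.I * (alphaj α j : ℂ)) ^ m₁ * mode α j (profile k α F j n) x := by
    simp only [mode]; ring
  have h2 : ∫ x, mode α j (profile k α F j 0) x * (QPVolumePotential.pderiv₂^[m₂] φ) x
      = (-1) ^ m₂ * ∫ x, mode α j (profile k α F j m₂) x * φ x := by
    have w0 := hasWeakDerivLine_profile_zero hk_re hk_im hkα hF j
    have w1 := hasWeakDerivLine_profile_one hk_re hk_im hkα hF j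
    have u0 := hU 0 (by norm_num)
    have u1 := hU 1 (by norm_num)
    have u2 := hU 2 le_rfl
    have hm₂ : m₂ ≤ 2 := by simp only at hm; omega
    interval_cases m₂
    · simp
    · simpa using integral_mode_mul_pderiv₂ hφ u0 u1 w0
    · simpa [integral_mode_mul_pderiv₂ hφ u1 u2 w1] using
        integral_mode_mul_pderiv₂ hφ.pderiv₂ u0 u1 w0
  simp only
  rw [(hφ.pderiv₂_iterate m₂).integral_mode_mul_pderiv₁_iterate (hU 0 (by norm_num)), pow_add,
    mul_assoc]
  congr 1
  simp only [hpull, mul_assoc, integral_const_mul, h2]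
  ring

/-- The candidate `v` is the `L²` sum of the differentiated modes; its norm is controlled by the
uniform profile bounds and Bessel's inequality. -/
lemma IsDensity.exists_hasWeakDeriv_potential {k : ℂ} (hk_re : 0 ≤ k.re) (hk_im : 0 ≤ k.im) {α : ℝ}
    (hkα : ∀ j : ℤ, k ^ 2 ≠ (alphaj α j : ℂ) ^ 2) (ρ : ℝ) (M : ℕ) (R : ℝ) :
    ∃ C : ℝ≥0, ∀ F : ℝ × ℝ → ℂ, IsDensity ρ F → ∀ m : ℕ × ℕ, m.1 + m.2 ≤ 2 →
      ∃ v, HasWeakDeriv (box M R) m (potential k α F) v ∧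
        MemLp v 2 (volume.restrict (box M R)) ∧
        eLpNorm v 2 (volume.restrict (box M R)) ^ 2 ≤ C * ∫⁻ y, ‖F y‖ₑ ^ 2 := by
  obtain ⟨C, hC⟩ := exists_lintegral_mul_profile_sq_le hk_re hk_im hkα ρ R
  refine ⟨Real.toNNReal (2 * ((2 * M + 1) * Real.pi)) * (C * Real.toNNReal (2 * Real.pi)),
    fun F hF m hm => ?_⟩
  have : IsFiniteMeasure ((volume : Measure (ℝ × ℝ)).restrict (box M R)) :=
    ⟨by simpa using volume_box_lt_top M R⟩
  set S := ∫⁻ y, ‖F y‖ₑ ^ 2 with hS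
  have hS' : S ≠ ⊤ := hF.lintegral_sq_lt_top.ne
  set B : ℝ≥0 := C * (Real.toNNReal (2 * Real.pi) * S.toNNReal) with hB
  have hBS : (B : ℝ≥0∞) = C * (ENNReal.ofReal (2 * Real.pi) * S) := by
    rw [hB, ENNReal.coe_mul, ENNReal.coe_mul, ENNReal.coe_toNNReal hS']; rfl
  have hsum (m : ℕ × ℕ) (hm : m.1 + m.2 ≤ 2) : ∑' j, ∫⁻ t in Set.Ioo (-R) R,
      ‖(Complex.I * (alphaj α j : ℂ)) ^ m.1 * profile k α F j m.2 t‖ₑ ^ 2 ≤ B := by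
    refine (ENNReal.tsum_le_tsum fun j => hC F hF j m hm).trans ?_
    rw [ENNReal.tsum_mul_left, hBS]
    gcongr
    exact hF.tsum_lintegral_coeff_sq_le α
  have hmeas (m : ℕ × ℕ) (j : ℤ) : Measurable fun t =>
      (Complex.I * (alphaj α j : ℂ)) ^ m.1 * profile k α F j m.2 t :=
    (hF.measurable_profile k α j m.2).const_mul _
  obtain ⟨v, hv, hvn, hvs⟩ := exists_memLp_hasSum_integral_mode α (hmeas m) M R (hsum m hm)
  have hU (j : ℤ) (n : ℕ) (hn : n ≤ 2) :
      IntegrableOn (mode α j (profile k α F j n)) (box M R) := by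
    refine MemLp.integrable one_le_two (memLp_two_of_lintegral_sq_lt_top
      (measurable_mode α j (hF.measurable_profile k α j n)).aestronglyMeasurable ?_)
    rw [lintegral_box_mode_sq α j (hF.measurable_profile k α j n)]
    refine ENNReal.mul_lt_top ENNReal.ofReal_lt_top ?_
    have := (ENNReal.le_tsum j).trans (hsum (0, n) (by simpa using hn))
    simp only [pow_zero, one_mul] at this
    exact this.trans_lt ENNReal.coe_lt_top
  refine ⟨v, ⟨?_, ?_, fun φ h1 h2 h3 => ?_⟩, hv, hvn.trans_eq ?_⟩
  · have := (integrable_potential_and_hasSum hk_re hk_im hkα hF M R (χ := fun _ => 1)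
      measurable_const (K := 1) (by simp)).1
    simp only [mul_one] at this
    exact this.locallyIntegrableOn
  · exact IntegrableOn.locallyIntegrableOn (hv.integrable one_le_two)
  · have hφ : IsTest (box M R) φ := ⟨h1, h2, h3⟩
    have hχ := (hφ.pderiv₂_iterate m.2).pderiv₁_iterate m.1
    obtain ⟨K, hK⟩ := hχ.exists_bound
    have s1 := (integrable_potential_and_hasSum hk_re hk_im hkα hF M R
      hχ.contDiff.continuous.measurable hK).2
    obtain ⟨K', hK'⟩ := hφ.exists_bound
    have s2 := (hvs φ (MemLp.of_bound h1.continuous.aestronglyMeasurable K'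
      (Filter.Eventually.of_forall hK'))).mul_left ((-1 : ℂ) ^ (m.1 + m.2))
    -- Both sides of the weak identity are sums of series, and the series agree term by term.
    refine s1.unique (s2.congr_fun fun j => ?_)
    rw [hχ.setIntegral_mul_eq, hφ.setIntegral_mul_eq]
    exact hφ.integral_mode_profile_mul_pderiv hk_re hk_im hkα hF (hU j) hm
  · rw [hBS, ENNReal.coe_mul, ENNReal.coe_mul]
    simp only [mul_assoc]
    rfl

/-! ### Generalities on weak derivatives -/

/-- A test function in the smaller set is one in the larger set, and all integrals can be taken over
the plane. -/
lemma HasWeakDeriv.mono {U U' : Set (ℝ × ℝ)} (hU : U' ⊆ U) {m : ℕ × ℕ} {u v : ℝ × ℝ → ℂ}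
    (h : HasWeakDeriv U m u v) : HasWeakDeriv U' m u v := by
  refine ⟨h.1.mono_set hU, h.2.1.mono_set hU, fun φ h1 h2 h3 => ?_⟩
  have hφ' : IsTest U' φ := ⟨h1, h2, h3⟩
  have hφ : IsTest U φ := ⟨h1, h2, h3.trans hU⟩
  have := h.2.2 φ h1 h2 hφ.tsupport_subset
  rwa [hφ.setIntegral_mul_eq, ((hφ.pderiv₂_iterate _).pderiv₁_iterate _).setIntegral_mul_eq,
    ← hφ'.setIntegral_mul_eq,
    ← ((hφ'.pderiv₂_iterate _).pderiv₁_iterate _).setIntegral_mul_eq] at this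

lemma IsTest.integrable_mul_of_locallyIntegrableOn {U : Set (ℝ × ℝ)} {φ v : ℝ × ℝ → ℂ}
    (hφ : IsTest U φ) (hv : LocallyIntegrableOn v U) : Integrable fun x => v x * φ x :=
  IsTest.integrable_mul ⟨hφ.contDiff, hφ.hasCompactSupport, subset_rfl⟩
    (hv.integrableOn_compact_subset hφ.tsupport_subset hφ.hasCompactSupport.isCompact)

/-- The fundamental lemma of the calculus of variations, for which real test functions suffice. -/
lemma HasWeakDeriv.ae_eq {U : Set (ℝ × ℝ)} (hU : IsOpen U) {m : ℕ × ℕ} {u v w : ℝ × ℝ → ℂ}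
    (hv : HasWeakDeriv U m u v) (hw : HasWeakDeriv U m u w) : v =ᵐ[volume.restrict U] w := by
  have h := hU.ae_eq_zero_of_integral_contDiff_smul_eq_zero (μ := volume)
    (hv.2.1.sub hw.2.1) fun g g1 g2 g3 => by
      have hφ : IsTest U fun x => (g x : ℂ) := by
        have hs : tsupport (fun x => (g x : ℂ)) ⊆ tsupport g :=
          closure_mono fun x hx hx' => hx (by simp [hx'])
        exact ⟨Complex.ofRealCLM.contDiff.comp g1, g2.comp_left Complex.ofReal_zero, hs.trans g3⟩
      have e := (hv.2.2 _ hφ.contDiff hφ.hasCompactSupport hφ.tsupport_subset).symm.trans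
        (hw.2.2 _ hφ.contDiff hφ.hasCompactSupport hφ.tsupport_subset)
      have e := mul_left_cancel₀ (pow_ne_zero _ (by norm_num)) e
      rw [hφ.setIntegral_mul_eq, hφ.setIntegral_mul_eq] at e
      calc ∫ x, g x • (v - w) x = ∫ x, (v x * (g x : ℂ) - w x * (g x : ℂ)) := by
            refine integral_congr_ae (Filter.Eventually.of_forall fun x => ?_)
            simp only [Pi.sub_apply, Complex.real_smul]; ring
        _ = 0 := by
            rw [integral_sub (hφ.integrable_mul_of_locallyIntegrableOn hv.2.1)
              (hφ.integrable_mul_of_locallyIntegrableOn hw.2.1), e, sub_self]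
  rw [Filter.EventuallyEq, ae_restrict_iff' hU.measurableSet]
  filter_upwards [h] with x hx hxU using sub_eq_zero.mp (hx hxU)

/-- `weakDeriv` is an arbitrary choice; uniqueness lets its norm be computed from any explicit
representative. -/
lemma HasWeakDeriv.eLpNorm_weakDeriv {U : Set (ℝ × ℝ)} (hU : IsOpen U) {m : ℕ × ℕ}
    {u v : ℝ × ℝ → ℂ} (hv : HasWeakDeriv U m u v) :
    eLpNorm (weakDeriv U m u) 2 (volume.restrict U) = eLpNorm v 2 (volume.restrict U) := by
  have h : ∃ v, HasWeakDeriv U m u v := ⟨v, hv⟩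
  rw [weakDeriv, dif_pos h]
  exact eLpNorm_congr_ae (h.choose_spec.ae_eq hU hv)

lemma MemH.mono {ℓ : ℕ} {U U' : Set (ℝ × ℝ)} (hU : U' ⊆ U) {u : ℝ × ℝ → ℂ} (h : MemH ℓ U u) :
    MemH ℓ U' u := fun m hm =>
  let ⟨v, hv, hv'⟩ := h m hm
  ⟨v, hv.mono hU, hv'.mono_measure (Measure.restrict_mono_set _ hU)⟩

lemma exists_disc_subset_box (c : ℝ × ℝ) (r : ℝ) : ∃ (M : ℕ) (R : ℝ), disc c r ⊆ box M R := by
  obtain ⟨M, hM⟩ := exists_nat_ge (|c.1| + |r|)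
  -- The absolute value is needed because `disc` depends only on `r ^ 2` and `r` may be negative.
  refine ⟨M, |c.2| + |r|, fun x hx => ?_⟩
  have hx : (x.1 - c.1) ^ 2 + (x.2 - c.2) ^ 2 < r ^ 2 := hx
  have h1 : |x.1 - c.1| < |r| := sq_lt_sq.mp (by nlinarith [sq_nonneg (x.2 - c.2)])
  have h2 : |x.2 - c.2| < |r| := sq_lt_sq.mp (by nlinarith [sq_nonneg (x.1 - c.1)])
  have h3 := abs_sub_abs_le_abs_sub x.1 c.1
  have h4 := abs_sub_abs_le_abs_sub x.2 c.2
  have h5 : (M : ℝ) ≤ (2 * M + 1) * Real.pi := by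
    nlinarith [Real.pi_gt_three, (Nat.cast_nonneg M : (0 : ℝ) ≤ M)]
  exact ⟨abs_lt.mp (by linarith), abs_lt.mp (by linarith)⟩

/-! ### Mapping properties -/

lemma isQuasiPeriodic_potential (k : ℂ) (α : ℝ) (F : ℝ × ℝ → ℂ) :
    IsQuasiPeriodic α (potential k α F) := by
  intro x₁ x₂
  have hg (z₁ z₂ : ℝ) : green k α (z₁ + 2 * Real.pi, z₂)
      = Complex.exp (2 * (Real.pi : ℂ) * Complex.I * (α : ℂ)) * green k α (z₁, z₂) := by
    rw [green, green, mul_left_comm]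
    congr 1
    -- A constant factor comes out of the sum whether or not the series converges, so no condition
    -- on `z₂` arises.
    rw [← tsum_mul_left]
    refine tsum_congr fun j => ?_
    simp only
    have : Complex.exp (Complex.I * (alphaj α j : ℂ) * ((z₁ + 2 * Real.pi : ℝ) : ℂ)
          + Complex.I * betaj k α j * ((|z₂| : ℝ) : ℂ))
        = Complex.exp (2 * (Real.pi : ℂ) * Complex.I * (α : ℂ)) * Complex.exp (Complex.I *
          (alphaj α j : ℂ) * (z₁ : ℂ) + Complex.I * betaj k α j * ((|z₂| : ℝ) : ℂ)) := by
      rw [← Complex.exp_add, Complex.exp_eq_exp_iff_exists_int]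
      exact ⟨j, by unfold alphaj; push_cast; ring⟩
    rw [this]
    ring
  rw [potential, potential, ← integral_const_mul]
  refine integral_congr_ae (Filter.Eventually.of_forall fun y => ?_)
  beta_reduce
  have := hg (x₁ - y.1) (x₂ - y.2)
  rw [show ((x₁ + 2 * Real.pi, x₂) : ℝ × ℝ) - y = (x₁ - y.1 + 2 * Real.pi, x₂ - y.2) from
    Prod.ext (by simp; ring) (by simp), this, mul_assoc]
  rfl

lemma isDensity_indicator {D : Set (ℝ × ℝ)} (hDm : MeasurableSet D) {ρ : ℝ} (hD : D ⊆ cell ρ)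
    (f : Lp ℂ 2 ((volume : Measure (ℝ × ℝ)).restrict D)) :
    IsDensity ρ (D.indicator f) ∧ ∫⁻ y, ‖D.indicator f y‖ₑ ^ 2 = ‖f‖ₑ ^ 2 := by
  have h : ∫⁻ y, ‖D.indicator f y‖ₑ ^ 2 = ‖f‖ₑ ^ 2 := by
    rw [Lp.enorm_def, eLpNorm_two_sq, ← lintegral_indicator hDm]
    refine lintegral_congr fun y => ?_
    by_cases hy : y ∈ D <;> simp [hy]
  refine ⟨⟨(Lp.stronglyMeasurable f).measurable.indicator hDm,
    fun y hy => Set.indicator_of_notMem (fun h => hy (hD h)) _, ?_⟩, h⟩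
  rw [h]
  exact ENNReal.pow_lt_top enorm_lt_top

lemma volumePotential_eq_potential {D : Set (ℝ × ℝ)} (hDm : MeasurableSet D) (k : ℂ) (α : ℝ)
    (f : Lp ℂ 2 ((volume : Measure (ℝ × ℝ)).restrict D)) :
    volumePotential k α D f = potential k α (D.indicator f) := by
  funext x
  rw [volumePotential, potential, ← integral_indicator hDm]
  refine integral_congr_ae (Filter.Eventually.of_forall fun y => ?_)
  by_cases hy : y ∈ D <;> simp [hy]

lemma isLinearMap_volumePotential {D : Set (ℝ × ℝ)} {k : ℂ} {α : ℝ}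
    (hi : ∀ (f : Lp ℂ 2 ((volume : Measure (ℝ × ℝ)).restrict D)) (x : ℝ × ℝ),
      IntegrableOn (fun y => green k α (x - y) * f y) D) :
    IsLinearMap ℂ (volumePotential k α D) where
  map_add f g := by
    funext x
    simp only [volumePotential, Pi.add_apply]
    rw [← integral_add (hi f x) (hi g x)]
    refine integral_congr_ae ?_
    filter_upwards [Lp.coeFn_add f g] with y hy
    rw [hy, Pi.add_apply, mul_add]
  map_smul c f := by
    funext x
    simp only [volumePotential, Pi.smul_apply, smul_eq_mul]
    rw [← integral_const_mul]
    refine integral_congr_ae ?_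
    filter_upwards [Lp.coeFn_smul c f] with y hy
    rw [hy, Pi.smul_apply, smul_eq_mul, mul_left_comm]

/-- Each of the `ℓ + 1` orders has at most `ℓ + 1` multi-indices; the overcount is harmless. -/
lemma normH_le {ℓ : ℕ} {U : Set (ℝ × ℝ)} (hU : IsOpen U) {u : ℝ × ℝ → ℂ} {B : ℝ≥0∞}
    (h : ∀ m : ℕ × ℕ, m.1 + m.2 ≤ ℓ → ∃ v, HasWeakDeriv U m u v ∧
      eLpNorm v 2 (volume.restrict U) ^ 2 ≤ B) :
    normH ℓ U u ≤ (((ℓ + 1) * (ℓ + 1) : ℕ) * B) ^ (1 / 2 : ℝ) := by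
  unfold normH
  gcongr
  have hterm (n : ℕ) (hn : n ∈ Finset.range (ℓ + 1)) :
      ∑ m ∈ Finset.HasAntidiagonal.antidiagonal n,
        eLpNorm (weakDeriv U m u) 2 ((volume : Measure (ℝ × ℝ)).restrict U) ^ 2
      ≤ ((ℓ + 1 : ℕ) : ℝ≥0∞) * B := by
    have hn' : n ≤ ℓ := Nat.lt_succ_iff.mp (Finset.mem_range.mp hn)
    refine (Finset.sum_le_card_nsmul _ _ B fun m hm => ?_).trans ?_
    · obtain ⟨v, hv, hB⟩ := h m (by rwa [Finset.HasAntidiagonal.mem_antidiagonal.mp hm])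
      rwa [hv.eLpNorm_weakDeriv hU]
    · rw [Finset.Nat.card_antidiagonal, nsmul_eq_mul]
      gcongr
  refine (Finset.sum_le_card_nsmul _ _ _ hterm).trans_eq ?_
  rw [Finset.card_range, nsmul_eq_mul, Nat.cast_mul, mul_assoc]

end QPVolumePotential

theorem mainTheorem7 (k : ℂ) (hk_re : 0 ≤ k.re) (hk_im : 0 ≤ k.im) (α : ℝ)
    (hkα : ∀ j : ℤ, k ^ 2 ≠ (QPVolumePotential.alphaj α j : ℂ) ^ 2)
    (ρ : ℝ) (D : Set (ℝ × ℝ)) (hDm : MeasurableSet D) (hD : D ⊆ QPVolumePotential.cell ρ) :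
    (∀ (f : Lp ℂ 2 ((volume : Measure (ℝ × ℝ)).restrict D)) (x : ℝ × ℝ),
      IntegrableOn (fun y => QPVolumePotential.green k α (x - y) * f y) D) ∧
    IsLinearMap ℂ (QPVolumePotential.volumePotential k α D) ∧
    ∀ R : ℝ, 0 < R →
      (∀ f : Lp ℂ 2 ((volume : Measure (ℝ × ℝ)).restrict D),
        QPVolumePotential.MemHalpha 2 α R (QPVolumePotential.volumePotential k α D f)) ∧
      ∃ C : ℝ≥0, ∀ f : Lp ℂ 2 ((volume : Measure (ℝ × ℝ)).restrict D),
        QPVolumePotential.normH 2 (QPVolumePotential.cell R)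
          (QPVolumePotential.volumePotential k α D f) ≤ (C : ℝ≥0∞) * ‖f‖ₑ := by
  have hdens := fun f => QPVolumePotential.isDensity_indicator hDm hD f
  have hint : ∀ (f : Lp ℂ 2 ((volume : Measure (ℝ × ℝ)).restrict D)) (x : ℝ × ℝ),
      IntegrableOn (fun y => QPVolumePotential.green k α (x - y) * f y) D := by
    intro f x
    refine (QPVolumePotential.integrable_green_mul_and_hasSum hk_re hk_im hkα
      (hdens f).1 x).1.integrableOn.congr_fun (fun y hy => ?_) hDm
    simp [hy]
  have hH (M : ℕ) (R : ℝ) (f : Lp ℂ 2 ((volume : Measure (ℝ × ℝ)).restrict D)) :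
      QPVolumePotential.MemH 2 (QPVolumePotential.box M R)
        (QPVolumePotential.volumePotential k α D f) := by
    obtain ⟨C, hC⟩ :=
      QPVolumePotential.IsDensity.exists_hasWeakDeriv_potential hk_re hk_im hkα ρ M R
    intro m hm
    obtain ⟨v, hv, hv2, _⟩ := hC _ (hdens f).1 m hm
    rw [QPVolumePotential.volumePotential_eq_potential hDm]
    exact ⟨v, hv, hv2⟩
  refine ⟨hint, QPVolumePotential.isLinearMap_volumePotential hint, fun R _ => ⟨fun f => ⟨?_, ?_⟩, ?_⟩⟩
  · rw [← QPVolumePotential.box_zero]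
    exact hH 0 R f
  · refine ⟨QPVolumePotential.volumePotential k α D f, ?_, fun c r => ?_, Filter.EventuallyEq.rfl⟩
    · rw [QPVolumePotential.volumePotential_eq_potential hDm]
      exact QPVolumePotential.isQuasiPeriodic_potential k α _
    · obtain ⟨M, R', hMR⟩ := QPVolumePotential.exists_disc_subset_box c r
      exact (hH M R' f).mono hMR
  · obtain ⟨C, hC⟩ :=
      QPVolumePotential.IsDensity.exists_hasWeakDeriv_potential hk_re hk_im hkα ρ 0 R
    -- `9 = (2 + 1)²` is the multi-index count from `normH_le` with `ℓ = 2`.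
    refine ⟨(9 * C) ^ (1 / 2 : ℝ), fun f => ?_⟩
    rw [QPVolumePotential.volumePotential_eq_potential hDm, ← QPVolumePotential.box_zero]
    refine (QPVolumePotential.normH_le (QPVolumePotential.isOpen_box 0 R) (B := C * ‖f‖ₑ ^ 2)
      fun m hm => ?_).trans_eq ?_
    · obtain ⟨v, hv, _, hvC⟩ := hC _ (hdens f).1 m hm
      exact ⟨v, hv, hvC.trans_eq (by rw [(hdens f).2])⟩
    · rw [← mul_assoc, ENNReal.mul_rpow_of_nonneg _ _ (by norm_num), ← ENNReal.rpow_natCast_mul,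
        ENNReal.coe_rpow_of_nonneg _ (by norm_num)]
      norm_num
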